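/- Let $n\ge 1$ and let $\mathfrak C=\{0,1\}^{\mathbb N}$ be the Cantor set. A basic dyadic block of $\mathfrak C^n$ is a product $w_1\mathfrak C\times\dots\times w_n\mathfrak C$ with finite binary words $w_i$ (equivalently, a product of basic dyadic intervals of the unit cube); a map takes the block given by $(w_i)$ affinely onto the block given by $(w_i')$ if it sends $(w_1s_1,\dots,w_ns_n)$ to $(w_1's_1,\dots,w_n's_n)$. A dyadic subdivision is a partition into basic dyadic blocks obtained from the whole cube by successively halving blocks in one of the $n$ coordinate directions; it is recorded by a finite binary tree with $n$ types of carets, one for each direction. The higher dimensional Thompson group $nV$ consists of the bijections of $\mathfrak C^n$ that map each block of some dyadic subdivision affinely onto a basic dyadic block. A tree-pair diagram for $x\in nV$ is a pair of such trees (source and target) with a bijection between their leaves, such that $x$ maps each block of the source subdivision affinely onto the corresponding block of the target subdivision. It is a grid diagram if the source is a grid, that is, the product of dyadic subdivisions, given by binary trees $T_1,\dots,T_n$, of the $n$ coordinates; its number of carets is that of its source tree, i.e. the number of blocks minus one. A grid diagram for $x$ is reduced if erasing any exposed caret (a caret both of whose children are leaves) of any $T_i$ yields a grid that is not the source of any grid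 diagram for $x$. In $2V$, with "vertical" carets halving the first and "horizontal" carets halving the second coordinate, let $R_k$ be the tree consisting of $k$ vertical carets, each but the first attached to the right leaf of the preceding one, with leaves numbered $0,\dots,k$ from left to right. Let $A_i$ (resp. $B_i$) be the element whose source tree is $R_{i+1}$ with an additional vertical (resp. horizontal) caret at leaf $i$, whose target tree is $R_{i+2}$, and which matches the leaves in left-to-right order; let $\Pi_i$ interchange the leaves $i,i+1$ of $R_{i+2}$ and $\overline\Pi_i$ interchange the leaves $i,i+1$ of $R_{i+1}$. Brin's generating set is $\Sigma=\{A_0,A_1,B_0,B_1,\Pi_0,\Pi_1,\overline\Pi_0,\overline\Pi_1\}$. **Theorem.** (1) $\Sigma$ generates $2V$ and every element of $2V$ has a reduced grid diagram. There is a constant $C>0$ such that for every $x\in 2V$, with $|x|$ its word length with respect to $\Sigma$ and $M(x)$ the number of carets of a reduced grid diagram for $x$, $$\log M(x)\le C\,|x|+C\qquad\text{and}\qquad |x|\le C\,M(x)\log M(x)+C ,$$ where $\log 0$ is read as $0$ (the case $x=1$). (2) For every $n\ge 1$ the group $nV$ is finitely generated, every element of $nV$ has a reduced grid diagram, and for every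 finite generating set $S$ of $nV$ there is a constant $C>0$ such that the same two inequalities hold for every $x\in nV$ and every reduced grid diagram for $x$, with $|x|$ the word length with respect to $S$ and $M(x)$ the number of carets of the diagram. -/

import Mathlib

namespace HigherThompson

/-! ### Words, blocks, and the Cantor model of the cube -/

/-- The `n`-dimensional cube in its Cantor model: each coordinate is given by its infinite binary
expansion (a point of the Cantor set). -/
abbrev Cube (n : ℕ) : Type := Fin n → Stream' Bool

/-- A basic dyadic block: the product of `n` basic dyadic intervals. The basic dyadic interval
`[(i-1)/2^k, i/2^k]` is given by the binary word of length `k` that all its points start with. -/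
abbrev Block (n : ℕ) : Type := Fin n → List Bool

/-- The affine identification of the cube with the block `b`, in every coordinate orientation
preserving: on binary expansions it prepends the word `b i` to the `i`-th coordinate. -/
def Block.embed {n : ℕ} (b : Block n) (s : Cube n) : Cube n := fun i => b i ++ₛ s i

/-- `f` maps the block `b` affinely (coordinatewise increasing) onto the block `c`. -/
def MapsBlock {n : ℕ} (f : Cube n → Cube n) (b c : Block n) : Prop :=
  ∀ s : Cube n, f (b.embed s) = c.embed s

/-! ### Dyadic subdivisions of the cube, given by trees with `n` types of carets -/

/-- A binary tree with `n` types of carets. A caret of type `i` halves a block in direction `i`. -/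
inductive DTree (n : ℕ) : Type
  | leaf : DTree n
  | caret (i : Fin n) (l r : DTree n) : DTree n

/-- The number of carets. -/
def DTree.carets {n : ℕ} : DTree n → ℕ
  | .leaf => 0
  | .caret _ l r => l.carets + r.carets + 1

/-- The block that corresponds to `b` when the cube is identified affinely with its lower
(`a = false`) or upper (`a = true`) half in direction `i`. -/
def Block.inHalf {n : ℕ} (i : Fin n) (a : Bool) (b : Block n) : Block n :=
  Function.update b i (a :: b i)

/-- The blocks of the subdivision given by a tree: its leaves, from left to right. -/
def DTree.leaves {n : ℕ} : DTree n → List (Block n)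
  | .leaf => [fun _ => []]
  | .caret i l r =>
      l.leaves.map (Block.inHalf i false) ++ r.leaves.map (Block.inHalf i true)

/-! ### The group `nV` -/

section Group

variable {n : ℕ}

theorem Block.embed_append (b w : Block n) (s : Cube n) :
    Block.embed (fun i => b i ++ w i) s = b.embed (w.embed s) := by
  funext i
  simp [Block.embed]

theorem MapsBlock.append {f : Cube n → Cube n} {b c : Block n} (h : MapsBlock f b c)
    (w : Block n) : MapsBlock f (fun i => b i ++ w i) (fun i => c i ++ w i) := by
  intro s
  rw [Block.embed_append, Block.embed_append, h]

theorem DTree.exists_leaf_prefix (t : DTree n) (b : Block n)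
    (hb : ∀ i, t.carets ≤ (b i).length) :
    ∃ c ∈ t.leaves, ∃ w : Block n, b = fun i => c i ++ w i := by
  induction t generalizing b with
  | leaf => exact ⟨fun _ => [], by simp [DTree.leaves], b, by simp⟩
  | caret i l r ihl ihr =>
    have key : ∀ (t : DTree n) (a : Bool) (tl : List Bool),
        (∀ b : Block n, (∀ i, t.carets ≤ (b i).length) →
          ∃ c ∈ t.leaves, ∃ w : Block n, b = fun i => c i ++ w i) →
        t.carets ≤ tl.length → (∀ j, t.carets ≤ (b j).length) → b i = a :: tl →
        ∃ c ∈ t.leaves.map (Block.inHalf i a), ∃ w : Block n, b = fun i => c i ++ w i := by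
      intro t a tl ih h1 h2 h3
      obtain ⟨c, hc, w, hw⟩ := ih (Function.update b i tl) (by
        intro j
        by_cases hj : j = i
        · subst hj; simpa using h1
        · simpa [Function.update_of_ne hj] using h2 j)
      refine ⟨_, List.mem_map_of_mem hc, w, ?_⟩
      funext j
      have hwj := congrFun hw j
      by_cases hj : j = i
      · subst hj
        simp only [Function.update_self] at hwj
        simp [Block.inHalf, h3, hwj]
      · simp only [Function.update_of_ne hj] at hwj
        simp [Block.inHalf, Function.update_of_ne hj, hwj]
    have hi := hb i
    simp only [DTree.carets] at hb hi
    rcases hbi : b i with _ | ⟨a, tl⟩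
    · simp [hbi] at hi
    · simp only [hbi, List.length_cons] at hi
      simp only [DTree.leaves, List.mem_append]
      cases a
      · obtain ⟨c, hc, h⟩ := key l false tl ihl (by omega) (fun j => by have := hb j; omega) hbi
        exact ⟨c, Or.inl hc, h⟩
      · obtain ⟨c, hc, h⟩ := key r true tl ihr (by omega) (fun j => by have := hb j; omega) hbi
        exact ⟨c, Or.inr hc, h⟩

/-- The tree that subdivides every block in the directions of the list, one after the other. -/
def DTree.uniform : List (Fin n) → DTree n
  | [] => .leaf
  | i :: L => .caret i (DTree.uniform L) (DTree.uniform L)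

theorem DTree.length_of_mem_uniform (L : List (Fin n)) (b : Block n)
    (hb : b ∈ (DTree.uniform L).leaves) (j : Fin n) : (b j).length = L.count j := by
  induction L generalizing b with
  | nil =>
    simp only [DTree.uniform, DTree.leaves, List.mem_singleton] at hb
    simp [hb]
  | cons i L ih =>
    simp only [DTree.uniform, DTree.leaves, List.mem_append, List.mem_map] at hb
    rcases hb with ⟨c, hc, rfl⟩ | ⟨c, hc, rfl⟩ <;>
    · have := ih c hc
      by_cases hj : j = i
      · subst hj; simp [Block.inHalf, this]
      · have hj' : ¬ i = j := fun h => hj h.symm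
        simp [Block.inHalf, Function.update_of_ne hj, this, hj']

theorem DTree.exists_uniform (k : ℕ) :
    ∃ t : DTree n, ∀ b ∈ t.leaves, ∀ i, (b i).length = k := by
  refine ⟨DTree.uniform (List.replicate k (List.finRange n)).flatten, fun b hb i => ?_⟩
  rw [DTree.length_of_mem_uniform _ b hb, List.count_flatten]
  simp [List.count_eq_one_of_mem (List.nodup_finRange n) (List.mem_finRange i)]

theorem DTree.exists_leaf_embed (t : DTree n) (p : Cube n) :
    ∃ c ∈ t.leaves, ∃ s, p = c.embed s := by
  obtain ⟨c, hc, w, hw⟩ := t.exists_leaf_prefix (fun i => (p i).take t.carets) (by simp)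
  refine ⟨c, hc, w.embed (fun i => (p i).drop t.carets), ?_⟩
  rw [← Block.embed_append, ← hw]
  funext i
  simp [Block.embed, Stream'.append_take_drop]

theorem DTree.exists_bound {f : Cube n → Cube n} {t : DTree n}
    (h : ∀ b ∈ t.leaves, ∃ c, MapsBlock f b c) :
    ∃ K : ℕ, ∀ b ∈ t.leaves, ∃ c, MapsBlock f b c ∧ ∀ i, (c i).length ≤ K := by
  choose! c hc using h
  refine ⟨(t.leaves.map fun b => ∑ i, (c b i).length).sum, fun b hb => ⟨c b, hc b hb, fun i => ?_⟩⟩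
  refine le_trans ?_ (List.single_le_sum (by simp) _ (List.mem_map_of_mem hb))
  exact Finset.single_le_sum (f := fun i => (c b i).length) (by simp) (Finset.mem_univ i)

theorem Block.prefix_of_embed_eq {b c : Block n} {s s' : Cube n}
    (h : b.embed s = c.embed s') (hl : ∀ i, (c i).length ≤ (b i).length) :
    ∃ w : Block n, b = fun i => c i ++ w i := by
  refine ⟨fun i => (b i).drop (c i).length, ?_⟩
  funext i
  have hi : b i ++ₛ s i = c i ++ₛ s' i := congrFun h i
  have h1 : (b i).take (c i).length = c i := by
    rw [← Stream'.take_append_of_le_length _ _ (s i) (hl i), hi,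
      Stream'.take_append_of_le_length _ _ (s' i) le_rfl, List.take_length]
  conv_lhs => rw [← List.take_append_drop (c i).length (b i), h1]

end Group

/-- The higher dimensional Thompson group `nV`: the bijections `f` of the cube for which there is a
dyadic subdivision of the cube such that `f` maps each block of it affinely onto some basic dyadic
block. -/
def nV (n : ℕ) : Subgroup (Equiv.Perm (Cube n)) where
  carrier := {f | ∃ t : DTree n, ∀ b ∈ t.leaves, ∃ c : Block n, MapsBlock f b c}
  one_mem' := ⟨.leaf, fun b _ => ⟨b, fun _ => rfl⟩⟩
  mul_mem' := by
    rintro f g ⟨t, ht⟩ ⟨u, hu⟩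
    obtain ⟨v, hv⟩ := DTree.exists_uniform (n := n) (u.carets + t.carets)
    refine ⟨v, fun b hb => ?_⟩
    have hlen := hv b hb
    obtain ⟨d, hd, w, hw⟩ := u.exists_leaf_prefix (fun i => (b i).take u.carets)
      (fun i => by simp [hlen])
    obtain ⟨e, he⟩ := hu d hd
    have hg : MapsBlock g b (fun i => (e i ++ w i) ++ (b i).drop u.carets) := by
      have := (he.append w).append (fun i => (b i).drop u.carets)
      have hb' : (fun i => (d i ++ w i) ++ (b i).drop u.carets) = b := by
        funext i
        rw [← congrFun hw i, List.take_append_drop]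
      rwa [hb'] at this
    obtain ⟨d', hd', w', hw'⟩ := t.exists_leaf_prefix
      (fun i => (e i ++ w i) ++ (b i).drop u.carets) (fun i => by simp [hlen]; omega)
    obtain ⟨e', he'⟩ := ht d' hd'
    have hf := he'.append w'
    rw [← hw'] at hf
    exact ⟨_, fun s => by rw [Equiv.Perm.mul_apply, hg s, hf s]⟩
  inv_mem' := by
    rintro f ⟨t, ht⟩
    obtain ⟨K, hK⟩ := DTree.exists_bound ht
    obtain ⟨v, hv⟩ := DTree.exists_uniform (n := n) K
    refine ⟨v, fun b hb => ?_⟩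
    have hlen := hv b hb
    let z : Cube n := fun _ => Stream'.const false
    obtain ⟨d, hd, s, hs⟩ := t.exists_leaf_embed (f⁻¹ (b.embed z))
    obtain ⟨c, hc, hcK⟩ := hK d hd
    have h1 : b.embed z = c.embed s := by
      rw [← hc s, ← hs]; simp
    obtain ⟨w, hw⟩ := Block.prefix_of_embed_eq h1 (fun i => by rw [hlen]; exact hcK i)
    refine ⟨fun i => d i ++ w i, fun x => ?_⟩
    rw [Equiv.Perm.inv_eq_iff_eq, hc.append w x, ← hw]

/-! ### Tree-pair diagrams and grid diagrams -/

/-- A tree-pair diagram: two subdivisions of the cube, and a bijection between their blocks (both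
lists of leaves are numbered from left to right). -/
structure TreePair (n : ℕ) where
  source : DTree n
  target : DTree n
  perm : Fin source.leaves.length ≃ Fin target.leaves.length

/-- The diagram represents `f`: each block of the source subdivision is mapped affinely onto the
corresponding block of the target subdivision. -/
def TreePair.Represents {n : ℕ} (D : TreePair n) (f : Cube n → Cube n) : Prop :=
  ∀ j, MapsBlock f (D.source.leaves.get j) (D.target.leaves.get (D.perm j))

/-- A binary tree with one type of carets: a dyadic subdivision of the unit interval. -/
inductive BTree : Type
  | leaf : BTree
  | caret (l r : BTree) : BTree

/-- The tree `T`, drawn with carets of type `i`, with a copy of `t` hanging from each leaf. -/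
def BTree.hang {n : ℕ} (i : Fin n) (t : DTree n) : BTree → DTree n
  | .leaf => t
  | .caret l r => .caret i (l.hang i t) (r.hang i t)

/-- The tree of the grid subdivision that is the product of the subdivisions `T 0, …, T (n-1)` of
the coordinates: `T 0` at the root, a copy of `T 1` hanging from each of its leaves, and so on. -/
def gridTree {n : ℕ} (T : Fin n → BTree) : DTree n :=
  (List.finRange n).foldr (fun i t => (T i).hang i t) .leaf

/-- A grid (tree-pair) diagram: a tree-pair diagram whose source is a grid subdivision. -/
structure GridDiagram (n : ℕ) where
  coords : Fin n → BTree
  target : DTree n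
  perm : Fin (gridTree coords).leaves.length ≃ Fin target.leaves.length

/-- The underlying tree-pair diagram. -/
def GridDiagram.toTreePair {n : ℕ} (D : GridDiagram n) : TreePair n :=
  ⟨gridTree D.coords, D.target, D.perm⟩

/-- The number of carets of a grid diagram (of its source tree; the target tree has as many leaves,
hence as many carets). -/
def GridDiagram.carets {n : ℕ} (D : GridDiagram n) : ℕ := D.toTreePair.source.carets

/-- `t.Erase t'`: the tree `t'` arises from `t` by erasing one exposed caret. -/
inductive BTree.Erase : BTree → BTree → Prop
  | exposed : BTree.Erase (.caret .leaf .leaf) .leaf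
  | left {l l' : BTree} (r : BTree) (h : BTree.Erase l l') :
      BTree.Erase (.caret l r) (.caret l' r)
  | right (l : BTree) {r r' : BTree} (h : BTree.Erase r r') :
      BTree.Erase (.caret l r) (.caret l r')

/-- `D` is a reduced grid diagram of `f`: it represents `f`, and no exposed caret of any of its
coordinate trees can be erased, that is, after erasing one the map `f` is no longer represented by
a grid diagram with these coordinate trees. (The caret with leaves `I₁, I₂` of the `i`-th tree can be
erased iff `f` maps each of the blocks obtained by joining the two neighbours over `I₁` and `I₂`
affinely onto a basic dyadic block, and the images form a dyadic subdivision given by a tree; in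
dimension at most 2 the latter is automatic.) -/
def GridDiagram.IsReducedFor {n : ℕ} (D : GridDiagram n) (f : Cube n → Cube n) : Prop :=
  D.toTreePair.Represents f ∧
    ∀ (i : Fin n) (t' : BTree), (D.coords i).Erase t' →
      ¬ ∃ D' : GridDiagram n,
          D'.coords = Function.update D.coords i t' ∧ D'.toTreePair.Represents f

/-! ### Word length -/

/-- The word length of `x` with respect to `S`: the least length of a word in the elements of `S`
and their inverses whose product is `x`. -/
noncomputable def wordLength {G : Type*} [Group G] (S : Set G) (x : G) : ℕ :=
  sInf {k | ∃ w : List G, (∀ g ∈ w, g ∈ S ∨ g⁻¹ ∈ S) ∧ w.prod = x ∧ w.length = k}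

/-! ### Brin's generators of `2V`

Carets of type `0` are the triangular ones (vertical cuts), carets of type `1` the square ones
(horizontal cuts). -/

/-- The all-right tree with `k` carets, all triangular. -/
def allRight : ℕ → DTree 2
  | 0 => .leaf
  | k + 1 => .caret 0 .leaf (allRight k)

/-- The all-right tree with `i + 1` carets, all triangular, and a further caret of type `d` at the
leaf number `i` (counted from `0`). -/
def allRightWith (d : Fin 2) : ℕ → DTree 2
  | 0 => .caret 0 (.caret d .leaf .leaf) .leaf
  | i + 1 => .caret 0 .leaf (allRightWith d i)

theorem length_allRight (k : ℕ) : (allRight k).leaves.length = k + 1 := by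
  induction k with
  | zero => simp [allRight, DTree.leaves]
  | succ k ih => simp [allRight, DTree.leaves, ih]

theorem length_allRightWith (d : Fin 2) (i : ℕ) :
    (allRightWith d i).leaves.length = i + 3 := by
  induction i with
  | zero => simp [allRightWith, DTree.leaves]
  | succ k ih => simp [allRightWith, DTree.leaves, ih]

/-- The diagrams of `A_i` (`d = 0`) and `B_i` (`d = 1`): the `j`-th leaf of the source tree goes to
the `j`-th leaf of the all-right tree. -/
def splitDiagram (d : Fin 2) (i : ℕ) : TreePair 2 :=
  ⟨allRightWith d i, allRight (i + 2),
    finCongr ((length_allRightWith d i).trans (length_allRight (i + 2)).symm)⟩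

/-- The diagram that interchanges the leaves `i` and `i + 1` of the all-right tree with `k` carets
(leaves `0, …, k`) and fixes the other leaves. -/
def swapDiagram (k i : ℕ) (h : i < k) : TreePair 2 :=
  ⟨allRight k, allRight k,
    Equiv.swap ⟨i, by rw [length_allRight]; omega⟩ ⟨i + 1, by rw [length_allRight]; omega⟩⟩

/-- The diagrams of Brin's generators `A_i, B_i, Π_i, Π̄_i` of `2V`, for `i = 0, 1`. -/
def brinDiagrams : List (TreePair 2) :=
  [splitDiagram 0 0, splitDiagram 0 1, splitDiagram 1 0, splitDiagram 1 1,
    swapDiagram 2 0 (by norm_num), swapDiagram 3 1 (by norm_num),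
    swapDiagram 1 0 (by norm_num), swapDiagram 2 1 (by norm_num)]

/-- Brin's finite generating set `{A_0, A_1, B_0, B_1, Π_0, Π_1, Π̄_0, Π̄_1}` of `2V`. -/
def brinGenerators : Set (nV 2) :=
  {g | ∃ D ∈ brinDiagrams, D.Represents (g : Equiv.Perm (Cube 2))}

end HigherThompson

open HigherThompson

/-!
Upper bound. A subdivision of the cube with labelled blocks is a tree with labelled leaves, and an
element of `nV` carries one such tree to another one with the same labels. Regard a comb of subtrees
as a stack, and let finitely many elements of `nV` move the top of one stack to another one, or
split the top of a stack. With them the source tree with `M + 1` leaves is flattened into a comb in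
`O(M)` moves, the leaves of the comb are put into the order prescribed by the target tree by a radix
sort with three stacks, which takes `O(M)` moves for each of the `O(log M)` binary digits, and the
target tree is rebuilt.

Lower bound. A word of length `ℓ` is affine on all blocks that are at least `K = O(ℓ)` deep in every
coordinate, and changes the depth of a block by at most `K` there. Hence an exposed caret deeper
than `3K` in a coordinate tree of a grid diagram can be erased, so the coordinate trees of a reduced
one have depth at most `3K + 1`, and `M ≤ 2 ^ (n (3K + 1))`.

Brin's generators of `2V` connect every labelled tree to the comb with the same labels, and permute
the leaves of a comb, so that they connect any two trees with the same labels.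
-/

namespace HigherThompson

/-! ### Concatenation of blocks -/

section Blocks

variable {n : ℕ}

/-- The block that corresponds to `w` when the cube is identified affinely with the block `b`. -/
def Block.cat (b w : Block n) : Block n := fun i => b i ++ w i

/-- The whole cube, as a block. -/
def Block.root : Block n := fun _ => []

@[simp] theorem Block.cat_apply (b w : Block n) (i : Fin n) : b.cat w i = b i ++ w i := rfl

@[simp] theorem Block.root_apply (i : Fin n) : (Block.root : Block n) i = [] := rfl

@[simp] theorem Block.cat_root (b : Block n) : b.cat Block.root = b := by
  funext i; simp

@[simp] theorem Block.root_cat (b : Block n) : Block.root.cat b = b := rfl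

theorem Block.cat_assoc (a b c : Block n) : (a.cat b).cat c = a.cat (b.cat c) := by
  funext i; simp

theorem Block.inHalf_self (i : Fin n) (a : Bool) (b : Block n) :
    b.inHalf i a i = a :: b i := by
  simp [Block.inHalf]

theorem Block.inHalf_of_ne {i j : Fin n} (h : j ≠ i) (a : Bool) (b : Block n) :
    b.inHalf i a j = b j := by
  simp [Block.inHalf, h]

theorem Block.inHalf_cat (i : Fin n) (a : Bool) (b w : Block n) :
    (b.inHalf i a).cat w = (b.cat w).inHalf i a := by
  funext j
  by_cases h : j = i
  · subst h; simp [Block.inHalf]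
  · simp [Block.inHalf, h]

theorem Block.inHalf_eq_cat (i : Fin n) (a : Bool) (b : Block n) :
    b.inHalf i a = (Block.root.inHalf i a).cat b := by
  rw [Block.inHalf_cat, Block.root_cat]

theorem Block.inHalf_injective (i : Fin n) (a : Bool) :
    Function.Injective (Block.inHalf i a : Block n → Block n) := by
  intro b c h
  funext j
  have hj := congrFun h j
  by_cases e : j = i
  · subst e; simpa [Block.inHalf] using hj
  · simpa [Block.inHalf, e] using hj

theorem Block.inHalf_false_ne_inHalf_true (i : Fin n) (b c : Block n) :
    b.inHalf i false ≠ c.inHalf i true := fun h => by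
  simpa [Block.inHalf] using congrFun h i

theorem Block.embed_cat (b w : Block n) (s : Cube n) :
    (b.cat w).embed s = b.embed (w.embed s) := Block.embed_append b w s

theorem Block.embed_injective (b : Block n) : Function.Injective b.embed := by
  intro s s' h
  funext i
  exact (Stream'.append_right_inj _ _ _).1 (congrFun h i)

theorem Block.embed_inHalf_false_ne_embed_inHalf_true (i : Fin n) (b c : Block n) (s s' : Cube n) :
    (b.inHalf i false).embed s ≠ (c.inHalf i true).embed s' := fun h => by
  simpa [Block.embed, Block.inHalf, Stream'.cons_append_stream] using
    congrArg Stream'.head (congrFun h i)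

theorem eq_of_forall_appendStream_eq {α : Type*} [Nontrivial α] :
    ∀ {u v : List α}, (∀ s : Stream' α, u ++ₛ s = v ++ₛ s) → u = v
  | [], [], _ => rfl
  | [], a :: _, h => by
    obtain ⟨c, hc⟩ := exists_ne a
    exact absurd (congrArg Stream'.head (h (Stream'.const c))) hc
  | a :: _, [], h => by
    obtain ⟨c, hc⟩ := exists_ne a
    exact absurd (congrArg Stream'.head (h (Stream'.const c))) hc.symm
  | a :: u, b :: v, h => by
    have hcons (s : Stream' α) := Stream'.cons_injective2 (h s)
    obtain ⟨c⟩ := Nontrivial.to_nonempty (α := α)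
    rw [(hcons (Stream'.const c)).1, eq_of_forall_appendStream_eq fun s => (hcons s).2]

theorem Block.ext_embed {b c : Block n} (h : ∀ s, b.embed s = c.embed s) : b = c :=
  funext fun i => eq_of_forall_appendStream_eq fun s => congrFun (h fun _ => s) i

theorem MapsBlock.cat {f : Cube n → Cube n} {b c : Block n} (h : MapsBlock f b c)
    (w : Block n) : MapsBlock f (b.cat w) (c.cat w) := h.append w

theorem MapsBlock.target_unique {f : Cube n → Cube n} {b c c' : Block n}
    (h : MapsBlock f b c) (h' : MapsBlock f b c') : c = c' :=
  Block.ext_embed fun s => by rw [← h s, ← h' s]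

theorem MapsBlock.symm {f : Equiv.Perm (Cube n)} {b c : Block n}
    (h : MapsBlock f b c) : MapsBlock (f⁻¹ : Equiv.Perm (Cube n)) c b := by
  intro s
  rw [← h s]; simp

theorem MapsBlock.trans {f g : Equiv.Perm (Cube n)} {b c d : Block n}
    (h : MapsBlock f b c) (h' : MapsBlock g c d) :
    MapsBlock (g * f : Equiv.Perm (Cube n)) b d := by
  intro s
  rw [Equiv.Perm.mul_apply, h s, h' s]

end Blocks

/-! ### The leaves of a tree tile the cube -/

section Tiling

variable {n : ℕ}

theorem DTree.leaves_ne_nil (t : DTree n) : t.leaves ≠ [] := by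
  induction t with
  | leaf => simp [DTree.leaves]
  | caret i l r ihl _ => simp [DTree.leaves, ihl]

theorem DTree.length_leaves (t : DTree n) : t.leaves.length = t.carets + 1 := by
  induction t with
  | leaf => simp [DTree.leaves, DTree.carets]
  | caret i l r ihl ihr =>
    simp only [DTree.leaves, DTree.carets, List.length_append, List.length_map, ihl, ihr]
    omega

theorem DTree.eq_of_embed_eq (t : DTree n) {b c : Block n} (hb : b ∈ t.leaves)
    (hc : c ∈ t.leaves) {s s' : Cube n} (h : b.embed s = c.embed s') : b = c := by
  have embed_eq_of_inHalf {i : Fin n} {a : Bool} {b c : Block n}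
      (h : (b.inHalf i a).embed s = (c.inHalf i a).embed s') : b.embed s = c.embed s' := by
    rw [Block.inHalf_eq_cat, Block.inHalf_eq_cat i a c, Block.embed_cat, Block.embed_cat] at h
    exact Block.embed_injective _ h
  induction t generalizing b c with
  | leaf =>
    simp only [DTree.leaves, List.mem_singleton] at hb hc
    rw [hb, hc]
  | caret i l r ihl ihr =>
    simp only [DTree.leaves, List.mem_append, List.mem_map] at hb hc
    rcases hb with ⟨b, hb, rfl⟩ | ⟨b, hb, rfl⟩ <;> rcases hc with ⟨c, hc, rfl⟩ | ⟨c, hc, rfl⟩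
    · rw [ihl hb hc (embed_eq_of_inHalf h)]
    · exact (Block.embed_inHalf_false_ne_embed_inHalf_true i _ _ _ _ h).elim
    · exact (Block.embed_inHalf_false_ne_embed_inHalf_true i _ _ _ _ h.symm).elim
    · rw [ihr hb hc (embed_eq_of_inHalf h)]

theorem DTree.nodup_leaves (t : DTree n) : t.leaves.Nodup := by
  induction t with
  | leaf => simp [DTree.leaves]
  | caret i l r ihl ihr =>
    refine (ihl.map (Block.inHalf_injective i false)).append
      (ihr.map (Block.inHalf_injective i true)) fun b hb hc => ?_
    obtain ⟨b, -, rfl⟩ := List.mem_map.1 hb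
    obtain ⟨c, -, hc⟩ := List.mem_map.1 hc
    exact Block.inHalf_false_ne_inHalf_true i b c hc.symm

theorem perm_eq_of_mapsBlock {x y : Equiv.Perm (Cube n)} (t : DTree n)
    (h : ∀ b ∈ t.leaves, ∃ c, MapsBlock x b c ∧ MapsBlock y b c) : x = y := by
  ext1 p
  obtain ⟨b, hb, s, rfl⟩ := t.exists_leaf_embed p
  obtain ⟨c, hx, hy⟩ := h b hb
  rw [hx s, hy s]

end Tiling

/-! ### Labelled trees -/

section Labelled

variable {n : ℕ} {α κ : Type*}

/-- A labelled list of blocks in which the lists `L` and `R` are put into the two halves in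
direction `i`; if one of them is empty, the other one keeps the whole cube. -/
def joinLeaves (i : Fin n) : List (Block n × α) → List (Block n × α) → List (Block n × α)
  | [], R => R
  | p :: L, [] => p :: L
  | p :: L, q :: R =>
      (p :: L).map (Prod.map (Block.inHalf i false) id) ++
        (q :: R).map (Prod.map (Block.inHalf i true) id)

/-- A tree with `n` types of carets, with labelled leaves, some of which may be void. A caret with a
void child is ignored when the subdivision is formed. -/
inductive LTree (n : ℕ) (α : Type*) : Type _
  | nil : LTree n α
  | leaf (a : α) : LTree n α
  | node (i : Fin n) (l r : LTree n α) : LTree n α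

/-- The blocks of the subdivision given by a labelled tree, with their labels. -/
def LTree.leaves : LTree n α → List (Block n × α)
  | .nil => []
  | .leaf a => [(Block.root, a)]
  | .node i l r => joinLeaves i l.leaves r.leaves

/-- The labels of the leaves, from left to right. -/
def LTree.labels : LTree n α → List α
  | .nil => []
  | .leaf a => [a]
  | .node _ l r => l.labels ++ r.labels

/-- Substitution of trees for the leaves, according to their labels. -/
def LTree.bind (f : α → LTree n κ) : LTree n α → LTree n κ
  | .nil => .nil
  | .leaf a => f a
  | .node i l r => .node i (l.bind f) (r.bind f)

/-- The tree in which the leaves whose labels do not satisfy `m` are made void. -/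
def LTree.prune (m : α → Bool) : LTree n α → LTree n α
  | .nil => .nil
  | .leaf a => if m a then .leaf a else .nil
  | .node i l r => .node i (l.prune m) (r.prune m)

/-- The subdivision `t` with labels given by a function of its blocks. -/
def LTree.ofDTree (f : Block n → α) : DTree n → LTree n α
  | .leaf => .leaf (f Block.root)
  | .caret i l r => .node i (LTree.ofDTree (fun b => f (b.inHalf i false)) l)
      (LTree.ofDTree (fun b => f (b.inHalf i true)) r)

@[simp] theorem joinLeaves_nil_left (i : Fin n) (R : List (Block n × α)) :
    joinLeaves i [] R = R := rfl

@[simp] theorem joinLeaves_nil_right (i : Fin n) (L : List (Block n × α)) :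
    joinLeaves i L [] = L := by
  cases L <;> rfl

theorem joinLeaves_of_ne_nil (i : Fin n) {L R : List (Block n × α)} (hL : L ≠ [])
    (hR : R ≠ []) : joinLeaves i L R =
      L.map (Prod.map (Block.inHalf i false) id) ++
        R.map (Prod.map (Block.inHalf i true) id) := by
  obtain ⟨p, L, rfl⟩ := List.exists_cons_of_ne_nil hL
  obtain ⟨q, R, rfl⟩ := List.exists_cons_of_ne_nil hR
  rfl

theorem LTree.map_snd_leaves (T : LTree n α) : T.leaves.map Prod.snd = T.labels := by
  induction T with
  | nil => rfl
  | leaf a => rfl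
  | node i l r ihl ihr =>
    rw [LTree.leaves, LTree.labels, ← ihl, ← ihr]
    rcases l.leaves with _ | ⟨p, L⟩ <;> rcases r.leaves with _ | ⟨q, R⟩ <;>
      simp [joinLeaves, Function.comp_def]

theorem LTree.mem_labels {T : LTree n α} {a : α} : a ∈ T.labels ↔ ∃ p ∈ T.leaves, p.2 = a := by
  rw [← T.map_snd_leaves, List.mem_map]

theorem LTree.leaves_eq_nil {T : LTree n α} : T.leaves = [] ↔ T.labels = [] := by
  rw [← T.map_snd_leaves, List.map_eq_nil_iff]

theorem LTree.eq_of_snd_eq {T : LTree n α} (hT : T.labels.Nodup) {p q : Block n × α}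
    (hp : p ∈ T.leaves) (hq : q ∈ T.leaves) (h : p.2 = q.2) : p = q :=
  List.inj_on_of_nodup_map (T.map_snd_leaves ▸ hT) hp hq h

theorem LTree.labels_prune (m : α → Bool) (T : LTree n α) :
    (T.prune m).labels = T.labels.filter m := by
  induction T with
  | nil => rfl
  | leaf a => by_cases h : m a <;> simp [LTree.prune, LTree.labels, h]
  | node i l r ihl ihr => simp [LTree.prune, LTree.labels, ihl, ihr]

theorem LTree.leaves_ofDTree (t : DTree n) (f : Block n → α) :
    (LTree.ofDTree f t).leaves = t.leaves.map fun b => (b, f b) := by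
  induction t generalizing f with
  | leaf => rfl
  | caret i l r ihl ihr =>
    rw [LTree.ofDTree, LTree.leaves, ihl, ihr, joinLeaves_of_ne_nil, DTree.leaves]
    · simp [Function.comp_def]
    · simpa using l.leaves_ne_nil
    · simpa using r.leaves_ne_nil

theorem LTree.labels_ofDTree (t : DTree n) (f : Block n → α) :
    (LTree.ofDTree f t).labels = t.leaves.map f := by
  rw [← LTree.map_snd_leaves, LTree.leaves_ofDTree, List.map_map, Function.comp_def]

theorem LTree.exists_dtree (T : LTree n α) (h : T.leaves ≠ []) :
    ∃ t : DTree n, t.leaves = T.leaves.map Prod.fst := by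
  induction T with
  | nil => exact (h rfl).elim
  | leaf a => exact ⟨.leaf, rfl⟩
  | node i l r ihl ihr =>
    rw [LTree.leaves] at h ⊢
    by_cases hl : l.leaves = []
    · rw [hl] at h ⊢
      exact ihr h
    by_cases hr : r.leaves = []
    · rw [hr, joinLeaves_nil_right] at h ⊢
      exact ihl h
    obtain ⟨t, ht⟩ := ihl hl
    obtain ⟨u, hu⟩ := ihr hr
    refine ⟨.caret i t u, ?_⟩
    rw [joinLeaves_of_ne_nil i hl hr, DTree.leaves, ht, hu]
    simp [Function.comp_def]

theorem LTree.exists_leaf_embed {T : LTree n α} (hT : T.leaves ≠ []) (x : Cube n) :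
    ∃ p ∈ T.leaves, ∃ s, x = p.1.embed s := by
  obtain ⟨t, ht⟩ := T.exists_dtree hT
  obtain ⟨b, hb, hx⟩ := t.exists_leaf_embed x
  rw [ht, List.mem_map] at hb
  obtain ⟨p, hp, rfl⟩ := hb
  exact ⟨p, hp, hx⟩

theorem LTree.eq_of_embed_eq {T : LTree n α} {p q : Block n × α} (hp : p ∈ T.leaves)
    (hq : q ∈ T.leaves) {s s' : Cube n} (h : p.1.embed s = q.1.embed s') : p = q := by
  obtain ⟨t, ht⟩ := T.exists_dtree (List.ne_nil_of_mem hp)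
  have hpq : p.1 = q.1 := t.eq_of_embed_eq (ht ▸ List.mem_map_of_mem hp)
    (ht ▸ List.mem_map_of_mem hq) h
  exact List.inj_on_of_nodup_map (ht ▸ t.nodup_leaves) hp hq hpq

/-- Insertion of labelled lists of blocks into the blocks of a labelled list. -/
def substLeaves (F : κ → List (Block n × α)) (E : List (Block n × κ)) : List (Block n × α) :=
  E.flatMap fun p => (F p.2).map fun q => (p.1.cat q.1, q.2)

theorem mem_substLeaves {F : κ → List (Block n × α)} {E : List (Block n × κ)}
    {r : Block n × α} :
    r ∈ substLeaves F E ↔ ∃ p ∈ E, ∃ q ∈ F p.2, (p.1.cat q.1, q.2) = r := by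
  simp only [substLeaves, List.mem_flatMap, List.mem_map]

theorem substLeaves_ne_nil {F : κ → List (Block n × α)} {E : List (Block n × κ)}
    (hF : ∀ p ∈ E, F p.2 ≠ []) (hE : E ≠ []) : substLeaves F E ≠ [] := by
  obtain ⟨p, hp⟩ := List.exists_mem_of_ne_nil E hE
  obtain ⟨q, hq⟩ := List.exists_mem_of_ne_nil _ (hF p hp)
  exact List.ne_nil_of_mem (mem_substLeaves.2 ⟨p, hp, q, hq, rfl⟩)

theorem substLeaves_joinLeaves {F : κ → List (Block n × α)} (i : Fin n)
    {L R : List (Block n × κ)} (hL : ∀ p ∈ L, F p.2 ≠ []) (hR : ∀ p ∈ R, F p.2 ≠ []) :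
    substLeaves F (joinLeaves i L R) = joinLeaves i (substLeaves F L) (substLeaves F R) := by
  rcases eq_or_ne L [] with rfl | hL0
  · simp [substLeaves]
  rcases eq_or_ne R [] with rfl | hR0
  · simp [substLeaves]
  rw [joinLeaves_of_ne_nil i hL0 hR0,
    joinLeaves_of_ne_nil i (substLeaves_ne_nil hL hL0) (substLeaves_ne_nil hR hR0)]
  simp [substLeaves, List.flatMap_map, List.map_flatMap, Function.comp_def, Block.inHalf_cat]

theorem LTree.leaves_bind (f : κ → LTree n α) (e : LTree n κ) :
    (e.bind f).leaves = substLeaves (fun j => (f j).leaves)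
      (e.prune fun j => !(f j).leaves.isEmpty).leaves := by
  have ne_nil (e : LTree n κ) (p) (hp : p ∈ (e.prune fun j => !(f j).leaves.isEmpty).leaves) :
      (f p.2).leaves ≠ [] := by
    have hlabel := LTree.mem_labels.2 ⟨p, hp, rfl⟩
    rw [LTree.labels_prune] at hlabel
    simpa using (List.mem_filter.1 hlabel).2
  induction e with
  | nil => rfl
  | leaf a =>
    simp only [LTree.bind, LTree.prune]
    split_ifs with h
    · simp [LTree.leaves, substLeaves]
    · simpa [LTree.leaves, substLeaves] using h
  | node i l r ihl ihr =>
    simp only [LTree.bind, LTree.prune, LTree.leaves]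
    rw [substLeaves_joinLeaves i (ne_nil l) (ne_nil r), ihl, ihr]

end Labelled

/-! ### Maps that carry one labelled subdivision to another -/

section Carries

variable {n : ℕ} {α κ : Type*}

/-- `x` maps each block of the first list affinely onto a block of the second list with the same
label, and all blocks of the second list arise in this way. -/
def Carries (x : Equiv.Perm (Cube n)) (L L' : List (Block n × α)) : Prop :=
  (∀ p ∈ L, ∃ q ∈ L', q.2 = p.2 ∧ MapsBlock x p.1 q.1) ∧
    ∀ q ∈ L', ∃ p ∈ L, q.2 = p.2 ∧ MapsBlock x p.1 q.1

theorem Carries.of_perm {L L' : List (Block n × α)} (h : L.Perm L') : Carries 1 L L' :=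
  ⟨fun p hp => ⟨p, h.mem_iff.1 hp, rfl, fun _ => rfl⟩,
    fun p hp => ⟨p, h.mem_iff.2 hp, rfl, fun _ => rfl⟩⟩

theorem Carries.trans {x y : Equiv.Perm (Cube n)} {L L' L'' : List (Block n × α)}
    (h : Carries x L L') (h' : Carries y L' L'') : Carries (y * x) L L'' := by
  constructor
  · intro p hp
    obtain ⟨q, hq, hqp, hmap⟩ := h.1 p hp
    obtain ⟨r, hr, hrq, hmap'⟩ := h'.1 q hq
    exact ⟨r, hr, hrq.trans hqp, hmap.trans hmap'⟩
  · intro r hr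
    obtain ⟨q, hq, hrq, hmap'⟩ := h'.2 r hr
    obtain ⟨p, hp, hqp, hmap⟩ := h.2 q hq
    exact ⟨p, hp, hrq.trans hqp, hmap.trans hmap'⟩

theorem Carries.symm {x : Equiv.Perm (Cube n)} {L L' : List (Block n × α)}
    (h : Carries x L L') : Carries x⁻¹ L' L :=
  ⟨fun q hq => let ⟨p, hp, e, hpq⟩ := h.2 q hq; ⟨p, hp, e.symm, hpq.symm⟩,
    fun p hp => let ⟨q, hq, e, hpq⟩ := h.1 p hp; ⟨q, hq, e.symm, hpq.symm⟩⟩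

theorem Carries.subst {x : Equiv.Perm (Cube n)} {E E' : List (Block n × κ)}
    (h : Carries x E E') (F : κ → List (Block n × α)) :
    Carries x (substLeaves F E) (substLeaves F E') := by
  constructor
  · intro p hp
    obtain ⟨u, hu, w, hw, rfl⟩ := mem_substLeaves.1 hp
    obtain ⟨v, hv, e, huv⟩ := h.1 u hu
    exact ⟨(v.1.cat w.1, w.2), mem_substLeaves.2 ⟨v, hv, w, e ▸ hw, rfl⟩, rfl, huv.cat _⟩
  · intro p hp
    obtain ⟨v, hv, w, hw, rfl⟩ := mem_substLeaves.1 hp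
    obtain ⟨u, hu, e, huv⟩ := h.2 v hv
    exact ⟨(u.1.cat w.1, w.2), mem_substLeaves.2 ⟨u, hu, w, e ▸ hw, rfl⟩, rfl, huv.cat _⟩

theorem Carries.bind {x : Equiv.Perm (Cube n)} {e e' : LTree n κ} (f : κ → LTree n α)
    (h : Carries x (e.prune fun j => !(f j).leaves.isEmpty).leaves
      (e'.prune fun j => !(f j).leaves.isEmpty).leaves) :
    Carries x (e.bind f).leaves (e'.bind f).leaves := by
  rw [LTree.leaves_bind, LTree.leaves_bind f e']
  exact h.subst _

theorem Carries.unique {x y : Equiv.Perm (Cube n)} {T T' : LTree n α} (hT : T.leaves ≠ [])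
    (hT' : T'.labels.Nodup) (hx : Carries x T.leaves T'.leaves)
    (hy : Carries y T.leaves T'.leaves) : x = y := by
  obtain ⟨t, ht⟩ := T.exists_dtree hT
  refine perm_eq_of_mapsBlock t fun b hb => ?_
  rw [ht, List.mem_map] at hb
  obtain ⟨p, hp, rfl⟩ := hb
  obtain ⟨q, hq, hqp, hxp⟩ := hx.1 p hp
  obtain ⟨q', hq', hqp', hyp⟩ := hy.1 p hp
  obtain rfl : q = q' := LTree.eq_of_snd_eq hT' hq hq' (hqp.trans hqp'.symm)
  exact ⟨_, hxp, hyp⟩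

theorem exists_mapsBlock_of_labels_subset {T T' : LTree n α} (hT : T.leaves ≠ [])
    (h : T.labels ⊆ T'.labels) :
    ∃ f : Cube n → Cube n, ∀ p ∈ T.leaves, ∃ q ∈ T'.leaves, q.2 = p.2 ∧ MapsBlock f p.1 q.1 := by
  choose p hp s hs using LTree.exists_leaf_embed hT
  choose! q hq hqp using fun p hp => LTree.mem_labels.1 (h (LTree.mem_labels.2 ⟨p, hp, rfl⟩))
  refine ⟨fun x => (q (p x)).1.embed (s x), fun r hr => ⟨q r, hq r hr, hqp r hr, fun s' => ?_⟩⟩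
  have hpr : p (r.1.embed s') = r := LTree.eq_of_embed_eq (hp _) hr (hs _).symm
  have hs' : s (r.1.embed s') = s' := by
    refine Block.embed_injective r.1 ?_
    conv_rhs => rw [hs (r.1.embed s'), hpr]
  simp only [hpr, hs']

theorem leftInverse_of_mapsBlock {T T' : LTree n α} (hT : T.leaves ≠ []) (hnd : T.labels.Nodup)
    {f g : Cube n → Cube n}
    (hf : ∀ p ∈ T.leaves, ∃ q ∈ T'.leaves, q.2 = p.2 ∧ MapsBlock f p.1 q.1)
    (hg : ∀ q ∈ T'.leaves, ∃ p ∈ T.leaves, p.2 = q.2 ∧ MapsBlock g q.1 p.1) :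
    Function.LeftInverse g f := by
  intro x
  obtain ⟨p, hp, s, rfl⟩ := LTree.exists_leaf_embed hT x
  obtain ⟨q, hq, hqp, hfp⟩ := hf p hp
  obtain ⟨p', hp', hpq, hgq⟩ := hg q hq
  obtain rfl : p' = p := LTree.eq_of_snd_eq hnd hp' hp (hpq.trans hqp)
  rw [hfp s, hgq s]

theorem exists_carries {T T' : LTree n α} (hnd : T.labels.Nodup)
    (hperm : T.labels.Perm T'.labels) :
    ∃ x : nV n, Carries (x : Equiv.Perm (Cube n)) T.leaves T'.leaves := by
  have hnil : T.leaves = [] ↔ T'.leaves = [] := by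
    rw [LTree.leaves_eq_nil, LTree.leaves_eq_nil]
    exact ⟨fun h => (h ▸ hperm).nil_eq.symm, fun h => (h ▸ hperm).eq_nil⟩
  by_cases hT : T.leaves = []
  · exact ⟨1, by rw [hT, hnil.1 hT]; exact .of_perm (.refl _)⟩
  have hT' := hT ∘ hnil.2
  obtain ⟨f, hf⟩ := exists_mapsBlock_of_labels_subset hT hperm.subset
  obtain ⟨g, hg⟩ := exists_mapsBlock_of_labels_subset hT' hperm.symm.subset
  let x : Equiv.Perm (Cube n) := ⟨f, g, leftInverse_of_mapsBlock hT hnd hf hg,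
    leftInverse_of_mapsBlock hT' (hperm.nodup_iff.1 hnd) hg hf⟩
  obtain ⟨t, ht⟩ := T.exists_dtree hT
  refine ⟨⟨x, t, fun b hb => ?_⟩, hf, fun q hq => ?_⟩
  · rw [ht, List.mem_map] at hb
    obtain ⟨p, hp, rfl⟩ := hb
    obtain ⟨q, -, -, hpq⟩ := hf p hp
    exact ⟨q.1, hpq⟩
  · obtain ⟨p, hp, hpq, hqp⟩ := hg q hq
    exact ⟨p, hp, hpq.symm, MapsBlock.symm (f := x⁻¹) hqp⟩

end Carries

/-! ### Words in a group -/

section Words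

variable {G : Type*} [Group G] {S Γ : Set G}

/-- The list `w` is a word in the elements of `S` and their inverses. -/
def IsWord (S : Set G) (w : List G) : Prop := ∀ g ∈ w, g ∈ S ∨ g⁻¹ ∈ S

theorem IsWord.append {v w : List G} (hv : IsWord S v) (hw : IsWord S w) : IsWord S (v ++ w) :=
  fun g hg => (List.mem_append.1 hg).elim (hv g) (hw g)

theorem IsWord.reverse_map_inv {w : List G} (hw : IsWord S w) :
    IsWord S (w.map (·⁻¹)).reverse := by
  intro _ hmem
  obtain ⟨g, hg, rfl⟩ := List.mem_map.1 (List.mem_reverse.1 hmem)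
  simpa using (hw g hg).symm

theorem IsWord.prod_mem_closure {w : List G} (hw : IsWord S w) :
    w.prod ∈ Subgroup.closure S :=
  list_prod_mem fun g hg => (hw g hg).elim (Subgroup.mem_closure_of_mem ·)
    fun h => inv_mem_iff.1 (Subgroup.mem_closure_of_mem h)

theorem IsWord.wordLength_le {w : List G} (hw : IsWord S w) : wordLength S w.prod ≤ w.length :=
  Nat.sInf_le ⟨w, hw, rfl, rfl⟩

theorem exists_isWord_length_eq_wordLength {x : G} (hx : x ∈ Subgroup.closure S) :
    ∃ w : List G, IsWord S w ∧ w.prod = x ∧ w.length = wordLength S x := by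
  rw [← Subgroup.mem_toSubmonoid, Subgroup.closure_toSubmonoid] at hx
  obtain ⟨w, hw, hprod⟩ := Submonoid.exists_list_of_mem_closure hx
  exact Nat.sInf_mem (s := {k | ∃ w : List G, IsWord S w ∧ w.prod = x ∧ w.length = k})
    ⟨_, w, hw, hprod, rfl⟩

theorem wordLength_mul_le {x y : G} (hx : x ∈ Subgroup.closure S)
    (hy : y ∈ Subgroup.closure S) : wordLength S (x * y) ≤ wordLength S x + wordLength S y := by
  obtain ⟨v, hv, rfl, hv_length⟩ := exists_isWord_length_eq_wordLength hx
  obtain ⟨w, hw, rfl, hw_length⟩ := exists_isWord_length_eq_wordLength hy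
  rw [← hv_length, ← hw_length, ← List.prod_append, ← List.length_append]
  exact (hv.append hw).wordLength_le

theorem exists_wordLength_prod_le_mul_length (hΓ : Γ.Finite) (hS : Γ ⊆ Subgroup.closure S) :
    ∃ B : ℕ, ∀ w, IsWord Γ w → wordLength S w.prod ≤ B * w.length := by
  obtain ⟨B, hB⟩ := (hΓ.image fun g => max (wordLength S g) (wordLength S g⁻¹)).bddAbove
  refine ⟨B, fun w hw => ?_⟩
  induction w with
  | nil => exact IsWord.wordLength_le (w := []) (by simp [IsWord])
  | cons g w ih =>
    obtain ⟨hg, hw⟩ := List.forall_mem_cons.1 hw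
    have hg_mem : g ∈ Subgroup.closure S := hg.elim (hS ·) fun h => inv_mem_iff.1 (hS h)
    have hg_le : wordLength S g ≤ B := by
      rcases hg with h | h
      · exact (le_max_left _ _).trans (hB ⟨g, h, rfl⟩)
      · simpa using (le_max_right _ _).trans (hB ⟨g⁻¹, h, rfl⟩)
    have hw_mem := (Subgroup.closure_le _).2 hS (IsWord.prod_mem_closure hw)
    calc wordLength S (g :: w).prod ≤ wordLength S g + wordLength S w.prod := by
          rw [List.prod_cons]; exact wordLength_mul_le hg_mem hw_mem
      _ ≤ B + B * w.length := add_le_add hg_le (ih hw)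
      _ = B * (g :: w).length := by rw [List.length_cons]; ring

end Words

/-! ### Words that carry one labelled tree to another -/

section Reach

variable {n : ℕ} {α : Type*} {Γ : Set (nV n)} {T T' T'' : LTree n α}

/-- Some word of length at most `m` in the elements of `Γ` and their inverses carries the
subdivision given by the first tree to that given by the second one. -/
def Reach (Γ : Set (nV n)) (m : ℕ) (T T' : LTree n α) : Prop :=
  ∃ w : List (nV n), IsWord Γ w ∧ w.length ≤ m ∧
    Carries (w.prod : Equiv.Perm (Cube n)) T.leaves T'.leaves

theorem Reach.of_leaves_perm (h : T.leaves.Perm T'.leaves) : Reach Γ 0 T T' :=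
  ⟨[], by simp [IsWord], by simp, by simpa using Carries.of_perm h⟩

theorem Reach.of_leaves_eq (h : T.leaves = T'.leaves) : Reach Γ 0 T T' :=
  .of_leaves_perm (.of_eq h)

theorem Reach.refl (T : LTree n α) : Reach Γ 0 T T := .of_leaves_eq rfl

theorem Reach.of_mem {g : nV n} (hg : g ∈ Γ)
    (h : Carries (g : Equiv.Perm (Cube n)) T.leaves T'.leaves) : Reach Γ 1 T T' :=
  ⟨[g], by simp [IsWord, hg], by simp, by simpa using h⟩

theorem Reach.trans {m k : ℕ} (h : Reach Γ m T T') (h' : Reach Γ k T' T'') :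
    Reach Γ (m + k) T T'' := by
  obtain ⟨w, hw, hlen, hcarries⟩ := h
  obtain ⟨w', hw', hlen', hcarries'⟩ := h'
  refine ⟨w' ++ w, hw'.append hw, by rw [List.length_append]; omega, ?_⟩
  rw [List.prod_append, Subgroup.coe_mul]
  exact hcarries.trans hcarries'

theorem Reach.symm {m : ℕ} (h : Reach Γ m T T') : Reach Γ m T' T := by
  obtain ⟨w, hw, hlen, hcarries⟩ := h
  refine ⟨(w.map (·⁻¹)).reverse, hw.reverse_map_inv, by simpa using hlen, ?_⟩
  rw [← List.prod_inv_reverse, Subgroup.coe_inv]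
  exact hcarries.symm

theorem Reach.mono {m k : ℕ} (hmk : m ≤ k) (h : Reach Γ m T T') : Reach Γ k T T' := by
  obtain ⟨w, hw, hlen, hcarries⟩ := h
  exact ⟨w, hw, hlen.trans hmk, hcarries⟩

end Reach

/-! ### Tree-pair diagrams as labelled trees -/

section Diagrams

variable {n : ℕ}

theorem TreePair.carets_target (D : TreePair n) : D.target.carets = D.source.carets := by
  have hlen := Fin.equiv_iff_eq.1 ⟨D.perm⟩
  rw [DTree.length_leaves, DTree.length_leaves] at hlen
  omega

theorem TreePair.Represents.exists_image {x : Cube n → Cube n} {D : TreePair n}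
    (hD : D.Represents x) :
    ∃ f : Block n → Block n, (∀ c ∈ D.source.leaves, MapsBlock x c (f c)) ∧
      (D.source.leaves.map f).Perm D.target.leaves := by
  have hmaps : ∀ c ∈ D.source.leaves, ∃ d, MapsBlock x c d := by
    intro c hc
    obtain ⟨j, rfl⟩ := List.get_of_mem hc
    exact ⟨_, hD j⟩
  choose! f hf using hmaps
  have hsub : D.target.leaves ⊆ D.source.leaves.map f := by
    intro d hd
    obtain ⟨k, rfl⟩ := List.get_of_mem hd
    refine List.mem_map.2 ⟨D.source.leaves.get (D.perm.symm k), List.get_mem _ _, ?_⟩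
    simpa only [Equiv.apply_symm_apply] using
      (hf _ (List.get_mem _ _)).target_unique (hD (D.perm.symm k))
  refine ⟨f, hf, ((D.target.nodup_leaves.subperm hsub).perm_of_length_le ?_).symm⟩
  rw [List.length_map, DTree.length_leaves, DTree.length_leaves, D.carets_target]

theorem TreePair.Represents.exists_carries {x : Equiv.Perm (Cube n)} {D : TreePair n}
    (hD : D.Represents x) :
    ∃ f : Block n → Block n, (D.source.leaves.map f).Perm D.target.leaves ∧
      Carries x (LTree.ofDTree f D.source).leaves (LTree.ofDTree id D.target).leaves := by
  obtain ⟨f, hf, hperm⟩ := hD.exists_image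
  refine ⟨f, hperm, ?_⟩
  rw [LTree.leaves_ofDTree, LTree.leaves_ofDTree]
  constructor
  · intro p hp
    obtain ⟨c, hc, rfl⟩ := List.mem_map.1 hp
    exact ⟨(f c, f c), List.mem_map.2 ⟨f c, hperm.subset (List.mem_map_of_mem hc), rfl⟩, rfl,
      hf c hc⟩
  · intro q hq
    obtain ⟨d, hd, rfl⟩ := List.mem_map.1 hq
    obtain ⟨c, hc, rfl⟩ := List.mem_map.1 (hperm.symm.subset hd)
    exact ⟨(c, f c), List.mem_map.2 ⟨c, hc, rfl⟩, rfl, hf c hc⟩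

theorem Carries.unique_ofDTree {x y : Equiv.Perm (Cube n)} {s t : DTree n} {f : Block n → Block n}
    (hx : Carries x (LTree.ofDTree f s).leaves (LTree.ofDTree id t).leaves)
    (hy : Carries y (LTree.ofDTree f s).leaves (LTree.ofDTree id t).leaves) : x = y := by
  refine Carries.unique ?_ ?_ hx hy
  · simpa [LTree.leaves_ofDTree] using s.leaves_ne_nil
  · rw [LTree.labels_ofDTree, List.map_id]
    exact t.nodup_leaves

theorem TreePair.Represents.exists_word_of_reach {x : nV n} {D : TreePair n} {Γ : Set (nV n)}
    {m : ℕ} (hD : D.Represents (x : Equiv.Perm (Cube n)))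
    (h : ∀ f : Block n → Block n, (D.source.leaves.map f).Perm D.target.leaves →
      Reach Γ m (.ofDTree f D.source) (.ofDTree id D.target)) :
    ∃ w, IsWord Γ w ∧ w.prod = x ∧ w.length ≤ m := by
  obtain ⟨f, hperm, hcarries⟩ := hD.exists_carries
  obtain ⟨w, hw, hlen, hcarries'⟩ := h f hperm
  exact ⟨w, hw, Subtype.ext (hcarries'.unique_ofDTree hcarries), hlen⟩

end Diagrams

/-! ### A finite set of moves -/

section Moves

variable {n : ℕ} [NeZero n] {α : Type*}

/-- Pairs of trees with the same labels. With a comb of subtrees regarded as a stack, they describe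
moving the top of the first stack to the second or to the third one, and splitting the top of the
second stack. -/
def movePatterns (n : ℕ) [NeZero n] : List (LTree n (Fin 4) × LTree n (Fin 4)) :=
  (.node 0 (.node 0 (.leaf 0) (.leaf 1)) (.node 0 (.leaf 2) (.leaf 3)),
    .node 0 (.leaf 1) (.node 0 (.node 0 (.leaf 0) (.leaf 2)) (.leaf 3))) ::
  (.node 0 (.node 0 (.leaf 0) (.leaf 1)) (.node 0 (.leaf 2) (.leaf 3)),
    .node 0 (.leaf 1) (.node 0 (.leaf 2) (.node 0 (.leaf 0) (.leaf 3)))) ::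
  (List.finRange n).map fun i =>
    (.node 0 (.leaf 0) (.node 0 (.node i (.leaf 1) (.leaf 2)) (.leaf 3)),
      .node 0 (.leaf 0) (.node 0 (.leaf 1) (.node 0 (.leaf 2) (.leaf 3))))

/-- The elements of `nV` that perform a move; the parts of a pattern that are void are dropped. -/
def moves (n : ℕ) [NeZero n] : Set (nV n) :=
  {g | ∃ e ∈ movePatterns n, ∃ m : Fin 4 → Bool, (e.1.prune m).leaves ≠ [] ∧
    Carries (g : Equiv.Perm (Cube n)) (e.1.prune m).leaves (e.2.prune m).leaves}

theorem nodup_and_perm_of_mem_movePatterns {e : LTree n (Fin 4) × LTree n (Fin 4)}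
    (he : e ∈ movePatterns n) : e.1.labels.Nodup ∧ e.1.labels.Perm e.2.labels := by
  simp only [movePatterns, List.mem_cons, List.mem_map] at he
  rcases he with rfl | rfl | ⟨i, -, rfl⟩ <;> simp only [LTree.labels] <;> decide

theorem finite_moves (n : ℕ) [NeZero n] : (moves n).Finite := by
  have hsub : moves n ⊆ ⋃ e ∈ {e | e ∈ movePatterns n}, ⋃ m : Fin 4 → Bool,
      {g | (e.1.prune m).leaves ≠ [] ∧
        Carries (g : Equiv.Perm (Cube n)) (e.1.prune m).leaves (e.2.prune m).leaves} := by
    rintro g ⟨e, he, m, h⟩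
    simp only [Set.mem_iUnion]
    exact ⟨e, he, m, h⟩
  refine Set.Finite.subset ?_ hsub
  refine (List.finite_toSet _).biUnion fun e he => Set.finite_iUnion fun m => ?_
  refine Set.Subsingleton.finite ?_
  rintro g ⟨hne, hg⟩ g' ⟨-, hg'⟩
  obtain ⟨hnd, hperm⟩ := nodup_and_perm_of_mem_movePatterns he
  refine Subtype.ext (Carries.unique hne ?_ hg hg')
  rw [LTree.labels_prune]
  exact (hperm.nodup_iff.1 hnd).filter m

theorem Reach.move {e : LTree n (Fin 4) × LTree n (Fin 4)} (he : e ∈ movePatterns n)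
    (f : Fin 4 → LTree n α) : Reach (moves n) 1 (e.1.bind f) (e.2.bind f) := by
  set m : Fin 4 → Bool := fun j => !(f j).leaves.isEmpty with hm
  obtain ⟨hnd, hperm⟩ := nodup_and_perm_of_mem_movePatterns he
  have hperm' : (e.1.prune m).labels.Perm (e.2.prune m).labels := by
    rw [LTree.labels_prune, LTree.labels_prune]
    exact hperm.filter m
  by_cases hnil : (e.1.prune m).leaves = []
  · have hnil' : (e.2.prune m).leaves = [] := by
      rw [LTree.leaves_eq_nil] at hnil ⊢
      exact (hnil ▸ hperm').nil_eq.symm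
    refine Reach.mono zero_le_one (.of_leaves_eq ?_)
    rw [LTree.leaves_bind, LTree.leaves_bind f e.2, ← hm, hnil, hnil']
  · obtain ⟨x, hx⟩ := exists_carries (by rw [LTree.labels_prune]; exact hnd.filter m) hperm'
    exact .of_mem ⟨e, he, m, hnil, hx⟩ (hx.bind f)

theorem reach_move_second (a X Y Z : LTree n α) :
    Reach (moves n) 1 (.node 0 (.node 0 a X) (.node 0 Y Z))
      (.node 0 X (.node 0 (.node 0 a Y) Z)) :=
  Reach.move (e := (.node 0 (.node 0 (.leaf 0) (.leaf 1)) (.node 0 (.leaf 2) (.leaf 3)),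
    .node 0 (.leaf 1) (.node 0 (.node 0 (.leaf 0) (.leaf 2)) (.leaf 3))))
    (by simp [movePatterns]) ![a, X, Y, Z]

theorem reach_move_third (a X Y Z : LTree n α) :
    Reach (moves n) 1 (.node 0 (.node 0 a X) (.node 0 Y Z))
      (.node 0 X (.node 0 Y (.node 0 a Z))) :=
  Reach.move (e := (.node 0 (.node 0 (.leaf 0) (.leaf 1)) (.node 0 (.leaf 2) (.leaf 3)),
    .node 0 (.leaf 1) (.node 0 (.leaf 2) (.node 0 (.leaf 0) (.leaf 3)))))
    (by simp [movePatterns]) ![a, X, Y, Z]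

theorem reach_split (i : Fin n) (X l r Z : LTree n α) :
    Reach (moves n) 1 (.node 0 X (.node 0 (.node i l r) Z))
      (.node 0 X (.node 0 l (.node 0 r Z))) :=
  Reach.move (e := (.node 0 (.leaf 0) (.node 0 (.node i (.leaf 1) (.leaf 2)) (.leaf 3)),
    .node 0 (.leaf 0) (.node 0 (.leaf 1) (.node 0 (.leaf 2) (.leaf 3)))))
    (by simp [movePatterns]) ![X, l, r, Z]

/-! ### Stacks -/

/-- The comb whose leaves are labelled by the list; its last leaf is void. It plays the role of a
stack, whose top is the first element. -/
def comb : List α → LTree n α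
  | [] => .nil
  | a :: L => .node 0 (.leaf a) (comb L)

-- This reverses the first kind of move, with a void second stack `Y`.
theorem reach_push (a X Z : LTree n α) :
    Reach (moves n) 1 (.node 0 X (.node 0 a Z)) (.node 0 (.node 0 a X) Z) := by
  have hsource : Reach (moves n) 0 (.node 0 X (.node 0 a Z))
      (.node 0 X (.node 0 (.node 0 a .nil) Z)) := .of_leaves_eq (by simp [LTree.leaves])
  exact hsource.trans ((reach_move_second a X .nil Z).symm.trans (.of_leaves_eq rfl))

theorem reach_flatten_onto (t : DTree n) (f : Block n → α) (A : List α) (Z : LTree n α) :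
    Reach (moves n) (2 * t.carets + 1) (.node 0 (comb A) (.node 0 (.ofDTree f t) Z))
      (.node 0 (comb ((t.leaves.map f).reverse ++ A)) Z) := by
  induction t generalizing f A Z with
  | leaf => exact reach_push _ _ _
  | caret i l r ihl ihr =>
    have h := ((reach_split i (comb A) (.ofDTree (fun b => f (b.inHalf i false)) l)
      (.ofDTree (fun b => f (b.inHalf i true)) r) Z).trans (ihl _ A _)).trans (ihr _ _ Z)
    have hcarets : 1 + (2 * l.carets + 1) + (2 * r.carets + 1) =
        2 * (DTree.caret i l r).carets + 1 := by
      simp only [DTree.carets]; omega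
    rw [hcarets] at h
    simpa [LTree.ofDTree, DTree.leaves, Function.comp_def] using h

theorem reach_flatten (t : DTree n) (f : Block n → α) :
    Reach (moves n) (2 * t.carets + 1) (.ofDTree f t) (comb (t.leaves.map f).reverse) := by
  simpa [Reach, LTree.leaves, comb] using reach_flatten_onto t f [] .nil

/-- Three stacks, side by side. -/
def threeStacks (A B C : List α) : LTree n α := .node 0 (comb A) (.node 0 (comb B) (comb C))

theorem leaves_threeStacks_nil_nil (A : List α) :
    (threeStacks A [] [] : LTree n α).leaves = (comb A).leaves := by
  simp [threeStacks, LTree.leaves, comb]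

theorem reach_distribute (p : α → Bool) (A B C : List α) :
    Reach (moves n) A.length (threeStacks A B C)
      (threeStacks [] ((A.filter p).reverse ++ B) ((A.filter (!p ·)).reverse ++ C)) := by
  induction A generalizing B C with
  | nil => exact .refl _
  | cons a A ih =>
    rw [List.length_cons, add_comm]
    by_cases h : p a
    · have hmove : Reach (moves n) 1 (threeStacks (a :: A) B C) (threeStacks A (a :: B) C) :=
        reach_move_second _ _ _ _
      simpa [h] using hmove.trans (ih (a :: B) C)
    · have hmove : Reach (moves n) 1 (threeStacks (a :: A) B C) (threeStacks A B (a :: C)) :=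
        reach_move_third _ _ _ _
      simpa [h] using hmove.trans (ih B (a :: C))

theorem reach_gather_third (A B C : List α) :
    Reach (moves n) C.length (threeStacks A B C) (threeStacks (C.reverse ++ A) B []) := by
  induction C generalizing A with
  | nil => exact .refl _
  | cons c C ih =>
    have hmove : Reach (moves n) 1 (threeStacks A B (c :: C)) (threeStacks (c :: A) B C) :=
      (reach_move_third _ _ _ _).symm
    rw [List.length_cons, add_comm]
    simpa using hmove.trans (ih (c :: A))

theorem reach_gather_second (A B C : List α) :
    Reach (moves n) B.length (threeStacks A B C) (threeStacks (B.reverse ++ A) [] C) := by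
  induction B generalizing A with
  | nil => exact .refl _
  | cons b B ih =>
    have hmove : Reach (moves n) 1 (threeStacks A (b :: B) C) (threeStacks (b :: A) B C) :=
      (reach_move_second _ _ _ _).symm
    rw [List.length_cons, add_comm]
    simpa using hmove.trans (ih (b :: A))

theorem reach_partition (p : α → Bool) (A : List α) :
    Reach (moves n) (2 * A.length) (threeStacks A [] [])
      (threeStacks (A.filter p ++ A.filter (!p ·)) [] []) := by
  have h := ((reach_distribute (n := n) p A [] []).trans (reach_gather_third _ _ _)).trans
    (reach_gather_second _ _ _)
  have hlen := List.length_eq_length_filter_add (l := A) p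
  simp only [List.append_nil, List.reverse_reverse, List.length_reverse] at h
  exact h.mono (by omega)

/-! ### Radix sort -/

theorem pairwise_mod_two_pow_succ_partition (key : α → ℕ) (b : ℕ) {A : List α}
    (hA : A.Pairwise fun x y => key x % 2 ^ b ≤ key y % 2 ^ b) :
    (A.filter (fun x => key x / 2 ^ b % 2 = 0) ++
      A.filter (fun x => !decide (key x / 2 ^ b % 2 = 0))).Pairwise
        fun x y => key x % 2 ^ (b + 1) ≤ key y % 2 ^ (b + 1) := by
  have mod_succ (x : α) : key x % 2 ^ (b + 1) = key x % 2 ^ b + 2 ^ b * (key x / 2 ^ b % 2) := by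
    rw [pow_succ, Nat.mod_mul]
  have mod_lt (x : α) : key x % 2 ^ b < 2 ^ b := Nat.mod_lt _ (by positivity)
  simp only [List.pairwise_append, List.pairwise_filter, List.mem_filter, decide_eq_true_eq,
    Bool.not_eq_true', decide_eq_false_iff_not, Nat.mod_two_ne_zero, mod_succ]
  refine ⟨hA.imp fun h hx hy => ?_, hA.imp fun h hx hy => ?_, fun x ⟨_, hx⟩ y ⟨_, hy⟩ => ?_⟩
  · rw [hx, hy]; omega
  · rw [hx, hy]; omega
  · have := mod_lt x
    rw [hx, hy]; omega

theorem reach_radix_sort (key : α → ℕ) (A : List α) (b : ℕ) :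
    ∃ A' : List α, A'.Perm A ∧ A'.Pairwise (fun x y => key x % 2 ^ b ≤ key y % 2 ^ b) ∧
      Reach (moves n) (2 * A.length * b) (threeStacks A [] []) (threeStacks A' [] []) := by
  induction b with
  | zero => exact ⟨A, .refl _, by simp [Nat.mod_one, List.pairwise_of_forall], .refl _⟩
  | succ b ih =>
    obtain ⟨A', hperm, hsorted, hreach⟩ := ih
    refine ⟨_, (List.filter_append_perm _ A').trans hperm,
      pairwise_mod_two_pow_succ_partition key b hsorted, ?_⟩
    have h := hreach.trans (reach_partition (fun x => decide (key x / 2 ^ b % 2 = 0)) A')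
    rwa [hperm.length_eq, ← Nat.mul_succ] at h

theorem eq_of_perm_of_pairwise_idxOf_le [DecidableEq α] {R A : List α} (h : R.Perm A)
    (hA : A.Nodup) (hR : R.Pairwise fun x y => A.idxOf x ≤ A.idxOf y) : R = A := by
  have hsorted : A.Pairwise fun x y => A.idxOf x ≤ A.idxOf y := by
    rw [List.pairwise_iff_getElem]
    intro i j hi hj hij
    rw [hA.idxOf_getElem, hA.idxOf_getElem]
    exact hij.le
  refine List.Perm.eq_of_pairwise (fun x y hx _ hxy hyx => ?_) hR hsorted h
  exact (List.idxOf_inj (h.subset hx)).1 (le_antisymm hxy hyx)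

theorem reach_comb_of_perm {A A' : List α} (h : A.Perm A') (hA' : A'.Nodup) {b : ℕ}
    (hb : A'.length ≤ 2 ^ b) : Reach (moves n) (2 * A.length * b) (comb A) (comb A') := by
  classical
  obtain ⟨R, hRA, hsorted, hreach⟩ := reach_radix_sort (n := n) (fun a => A'.idxOf a) A b
  have hRA' : R.Perm A' := hRA.trans h
  have mod_eq (a : α) (ha : a ∈ R) : A'.idxOf a % 2 ^ b = A'.idxOf a :=
    Nat.mod_eq_of_lt ((List.idxOf_lt_length_iff.2 (hRA'.subset ha)).trans_le hb)
  have hR : R.Pairwise fun x y => A'.idxOf x ≤ A'.idxOf y :=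
    hsorted.imp_of_mem fun hx hy hxy => by rwa [mod_eq _ hx, mod_eq _ hy] at hxy
  rw [eq_of_perm_of_pairwise_idxOf_le hRA' hA' hR] at hreach
  simpa only [Reach, leaves_threeStacks_nil_nil] using hreach

theorem exists_word_of_represents {x : nV n} {D : TreePair n}
    (hD : D.Represents (x : Equiv.Perm (Cube n))) {b : ℕ} (hb : D.source.carets + 1 ≤ 2 ^ b) :
    ∃ w, IsWord (moves n) w ∧ w.prod = x ∧
      w.length ≤ (D.source.carets + 1) * (2 * b + 4) := by
  refine hD.exists_word_of_reach fun f hperm => ?_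
  have hsort : Reach (moves n) (2 * (D.source.carets + 1) * b)
      (comb (D.source.leaves.map f).reverse) (comb D.target.leaves.reverse) := by
    have hperm' : (D.source.leaves.map f).reverse.Perm D.target.leaves.reverse :=
      (List.reverse_perm _).trans (hperm.trans (List.reverse_perm _).symm)
    simpa [DTree.length_leaves] using reach_comb_of_perm hperm'
      (List.nodup_reverse.2 D.target.nodup_leaves) (b := b)
      (by rwa [List.length_reverse, DTree.length_leaves, D.carets_target])
  have hrebuild : Reach (moves n) (2 * D.source.carets + 1) (comb D.target.leaves.reverse)
      (.ofDTree id D.target) := by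
    simpa [D.carets_target] using (reach_flatten D.target id).symm
  exact (((reach_flatten D.source f).trans hsort).trans hrebuild).mono (by nlinarith)

end Moves

/-! ### Grids -/

section Grid

variable {n : ℕ}

/-- The dyadic intervals of the subdivision given by a binary tree: the words of its leaves, from
left to right. -/
def BTree.words : BTree → List (List Bool)
  | .leaf => [[]]
  | .caret l r => l.words.map (false :: ·) ++ r.words.map (true :: ·)

theorem BTree.words_ne_nil (T : BTree) : T.words ≠ [] := by
  induction T with
  | leaf => simp [BTree.words]
  | caret l r ihl _ => simp [BTree.words, ihl]

theorem BTree.mem_leaves_hang {i : Fin n} {t : DTree n} {T : BTree} {b : Block n} :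
    b ∈ (T.hang i t).leaves ↔
      ∃ w ∈ T.words, ∃ c ∈ t.leaves, b = Function.update c i (w ++ c i) := by
  induction T generalizing b with
  | leaf => simp [BTree.hang, BTree.words]
  | caret l r ihl ihr =>
    simp only [BTree.hang, BTree.words, DTree.leaves, List.mem_append, List.mem_map, ihl, ihr]
    constructor
    · rintro (⟨_, ⟨w, hw, c, hc, rfl⟩, rfl⟩ | ⟨_, ⟨w, hw, c, hc, rfl⟩, rfl⟩)
      · exact ⟨_, .inl ⟨w, hw, rfl⟩, c, hc, by simp [Block.inHalf]⟩
      · exact ⟨_, .inr ⟨w, hw, rfl⟩, c, hc, by simp [Block.inHalf]⟩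
    · rintro ⟨_, ⟨w, hw, rfl⟩ | ⟨w, hw, rfl⟩, c, hc, rfl⟩
      · exact .inl ⟨_, ⟨w, hw, c, hc, rfl⟩, by simp [Block.inHalf]⟩
      · exact .inr ⟨_, ⟨w, hw, c, hc, rfl⟩, by simp [Block.inHalf]⟩

theorem mem_leaves_foldr_hang {T : Fin n → BTree} {L : List (Fin n)} (hL : L.Nodup)
    {b : Block n} :
    b ∈ (L.foldr (fun i t => (T i).hang i t) DTree.leaf).leaves ↔
      ∀ i, (i ∈ L → b i ∈ (T i).words) ∧ (i ∉ L → b i = []) := by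
  induction L generalizing b with
  | nil => simp [DTree.leaves, funext_iff]
  | cons j L ih =>
    rw [List.nodup_cons] at hL
    rw [List.foldr_cons, BTree.mem_leaves_hang]
    constructor
    · rintro ⟨w, hw, c, hc, rfl⟩ i
      have hc := (ih hL.2).1 hc
      by_cases h : i = j
      · subst h
        simpa [(hc i).2 hL.1] using hw
      · simpa [h] using hc i
    · intro h
      refine ⟨b j, (h j).1 (by simp), Function.update b j [], (ih hL.2).2 fun i => ?_, by simp⟩
      by_cases e : i = j
      · subst e; simp [hL.1]
      · simpa [e] using h i

theorem mem_leaves_gridTree {T : Fin n → BTree} {b : Block n} :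
    b ∈ (gridTree T).leaves ↔ ∀ i, b i ∈ (T i).words := by
  rw [gridTree, mem_leaves_foldr_hang (List.nodup_finRange n)]
  simp

theorem BTree.length_leaves_hang (i : Fin n) (t : DTree n) (T : BTree) :
    (T.hang i t).leaves.length = T.words.length * t.leaves.length := by
  induction T with
  | leaf => simp [BTree.hang, BTree.words]
  | caret l r ihl ihr => simp [BTree.hang, BTree.words, DTree.leaves, ihl, ihr, add_mul]

theorem length_leaves_gridTree (T : Fin n → BTree) :
    (gridTree T).leaves.length = ∏ i, (T i).words.length := by
  rw [Fin.prod_univ_def, gridTree]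
  induction List.finRange n with
  | nil => rfl
  | cons i L ih => rw [List.foldr_cons, BTree.length_leaves_hang, ih, List.map_cons, List.prod_cons]

theorem BTree.length_words_le_two_pow {T : BTree} {d : ℕ} (h : ∀ w ∈ T.words, w.length ≤ d) :
    T.words.length ≤ 2 ^ d := by
  induction T generalizing d with
  | leaf => simpa [BTree.words] using Nat.one_le_two_pow
  | caret l r ihl ihr =>
    obtain ⟨w, hw⟩ := List.exists_mem_of_ne_nil _ l.words_ne_nil
    cases d with
    | zero => simpa using h (false :: w) (by simp [BTree.words, hw])
    | succ d =>
      have hl := ihl fun w hw => Nat.le_of_succ_le_succ (h (false :: w) (by simp [BTree.words, hw]))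
      have hr := ihr fun w hw => Nat.le_of_succ_le_succ (h (true :: w) (by simp [BTree.words, hw]))
      simp only [BTree.words, List.length_append, List.length_map, pow_succ]
      omega

theorem length_leaves_gridTree_le_two_pow {T : Fin n → BTree} {d : ℕ}
    (h : ∀ i, ∀ w ∈ (T i).words, w.length ≤ d) :
    (gridTree T).leaves.length ≤ 2 ^ (n * d) := by
  rw [length_leaves_gridTree, mul_comm, pow_mul]
  simpa using Finset.prod_le_pow_card Finset.univ _ _
    fun i _ => BTree.length_words_le_two_pow (h i)

/-- The binary tree all of whose leaves have depth `m`. -/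
def BTree.full : ℕ → BTree
  | 0 => .leaf
  | m + 1 => .caret (BTree.full m) (BTree.full m)

theorem BTree.mem_words_full {m : ℕ} {w : List Bool} :
    w ∈ (BTree.full m).words ↔ w.length = m := by
  induction m generalizing w with
  | zero => simp [BTree.full, BTree.words]
  | succ m ih => rcases w with _ | ⟨_ | _, w⟩ <;> simp [BTree.full, BTree.words, ih]

end Grid

/-! ### Existence of grid diagrams -/

section Tiled

variable {n : ℕ} {T : Fin n → BTree} {N : Block n}

/-- The block `N` has a dyadic subdivision each of whose blocks is the affine image under `x` of a
block of the grid `T`. For the whole cube this says that `T` is the source of a grid diagram of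
`x`. -/
def TiledByImages (x : Cube n → Cube n) (T : Fin n → BTree) (N : Block n) : Prop :=
  ∃ t : DTree n, ∀ c ∈ t.leaves, ∃ g ∈ (gridTree T).leaves, MapsBlock x g (N.cat c)

theorem TiledByImages.of_mapsBlock {x : Cube n → Cube n} {b : Block n} (h : MapsBlock x b N)
    (t : DTree n) (ht : ∀ d ∈ t.leaves, b.cat d ∈ (gridTree T).leaves) : TiledByImages x T N :=
  ⟨t, fun d hd => ⟨b.cat d, ht d hd, h.cat d⟩⟩

theorem TiledByImages.of_halves {x : Cube n → Cube n} (i : Fin n)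
    (h : ∀ a, TiledByImages x T (N.cat (Block.root.inHalf i a))) : TiledByImages x T N := by
  obtain ⟨l, hl⟩ := h false
  obtain ⟨r, hr⟩ := h true
  simp only [Block.cat_assoc, ← Block.inHalf_eq_cat] at hl hr
  refine ⟨.caret i l r, fun c hc => ?_⟩
  simp only [DTree.leaves, List.mem_append, List.mem_map] at hc
  rcases hc with ⟨c, hc, rfl⟩ | ⟨c, hc, rfl⟩
  exacts [hl c hc, hr c hc]

theorem TiledByImages.of_leaves {x : Cube n → Cube n} (t : DTree n)
    (h : ∀ c ∈ t.leaves, TiledByImages x T (N.cat c)) : TiledByImages x T N := by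
  induction t generalizing N with
  | leaf => simpa using h Block.root (List.mem_singleton.2 rfl)
  | caret i l r ihl ihr =>
    refine .of_halves i (Bool.rec (ihl fun c hc => ?_) (ihr fun c hc => ?_)) <;>
      rw [Block.cat_assoc, ← Block.inHalf_eq_cat]
    · exact h _ (List.mem_append_left _ (List.mem_map_of_mem hc))
    · exact h _ (List.mem_append_right _ (List.mem_map_of_mem hc))

theorem exists_equiv_mapsBlock {x : Equiv.Perm (Cube n)} {s t : DTree n}
    (h : ∀ c ∈ t.leaves, ∃ b ∈ s.leaves, MapsBlock x b c) :
    ∃ e : Fin s.leaves.length ≃ Fin t.leaves.length,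
      ∀ j, MapsBlock x (s.leaves.get j) (t.leaves.get (e j)) := by
  have preimage (k : Fin t.leaves.length) :
      ∃ j : Fin s.leaves.length, MapsBlock x (s.leaves.get j) (t.leaves.get k) := by
    obtain ⟨b, hb, hm⟩ := h _ (t.leaves.get_mem k)
    obtain ⟨j, rfl⟩ := List.get_of_mem hb
    exact ⟨j, hm⟩
  choose φ hφ using preimage
  have hinj : Function.Injective φ := fun k k' hk =>
    List.nodup_iff_injective_get.1 t.nodup_leaves ((hφ k).target_unique (hk ▸ hφ k'))
  have hsurj : Function.Surjective φ := by
    intro j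
    obtain ⟨c, hc, p, hp⟩ :=
      t.exists_leaf_embed (x ((s.leaves.get j).embed fun _ => Stream'.const false))
    obtain ⟨k, rfl⟩ := List.get_of_mem hc
    rw [← hφ k p] at hp
    exact ⟨k, List.nodup_iff_injective_get.1 s.nodup_leaves
      (s.eq_of_embed_eq (List.get_mem _ _) (List.get_mem _ _) (x.injective hp.symm))⟩
  have hbij : Function.Bijective φ := ⟨hinj, hsurj⟩
  refine ⟨(Equiv.ofBijective φ hbij).symm, fun j => ?_⟩
  obtain ⟨k, rfl⟩ := hsurj j
  rw [Equiv.ofBijective_symm_apply_apply]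
  exact hφ k

theorem exists_gridDiagram_iff {x : Equiv.Perm (Cube n)} :
    (∃ D : GridDiagram n, D.coords = T ∧ D.toTreePair.Represents x) ↔
      TiledByImages x T Block.root := by
  constructor
  · rintro ⟨D, rfl, hD⟩
    refine ⟨D.target, fun c hc => ?_⟩
    obtain ⟨k, rfl⟩ := List.get_of_mem hc
    obtain ⟨j, rfl⟩ := D.perm.surjective k
    exact ⟨_, List.get_mem _ j, hD j⟩
  · rintro ⟨t, ht⟩
    obtain ⟨e, he⟩ := exists_equiv_mapsBlock ht
    exact ⟨⟨T, t, e⟩, rfl, he⟩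

theorem exists_gridDiagram (x : nV n) :
    ∃ D : GridDiagram n, D.toTreePair.Represents (x : Equiv.Perm (Cube n)) := by
  obtain ⟨t, ht⟩ := x⁻¹.2
  obtain ⟨K, hK⟩ := DTree.exists_bound ht
  have htiled : TiledByImages (x : Equiv.Perm (Cube n)) (fun _ => BTree.full K) Block.root := by
    refine .of_leaves t fun c hc => ?_
    obtain ⟨b, hb, hlen⟩ := hK c hc
    refine .of_mapsBlock (b := b) (by simpa using hb.symm)
      (gridTree fun i => BTree.full (K - (b i).length)) fun d hd => ?_
    simp only [mem_leaves_gridTree, BTree.mem_words_full] at hd ⊢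
    intro i
    rw [Block.cat_apply, List.length_append, hd, Nat.add_sub_cancel' (hlen i)]
  obtain ⟨D, -, hD⟩ := exists_gridDiagram_iff.2 htiled
  exact ⟨D, hD⟩

theorem BTree.Erase.length_words_lt {t t' : BTree} (h : t.Erase t') :
    t'.words.length < t.words.length := by
  induction h with
  | exposed => simp [BTree.words]
  | left r h ih => simpa [BTree.words] using ih
  | right l h ih => simpa [BTree.words] using ih

theorem exists_isReducedFor (x : nV n) :
    ∃ D : GridDiagram n, D.IsReducedFor (x : Equiv.Perm (Cube n)) := by
  obtain ⟨D, hD, hmin⟩ := (measure fun D : GridDiagram n =>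
    ∑ i, (D.coords i).words.length).wf.has_min
      {D | D.toTreePair.Represents (x : Equiv.Perm (Cube n))} (exists_gridDiagram x)
  refine ⟨D, hD, fun i t' he ⟨D', hcoords, hD'⟩ => hmin D' hD' ?_⟩
  change ∑ j, (D'.coords j).words.length < ∑ j, (D.coords j).words.length
  rw [hcoords]
  refine Finset.sum_lt_sum (fun j _ => ?_) ⟨i, Finset.mem_univ i, by simpa using he.length_words_lt⟩
  obtain rfl | hj := eq_or_ne j i
  · simpa using he.length_words_lt.le
  · rw [Function.update_of_ne hj]

end Tiled

/-! ### Bounded distortion -/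

section BlockBound

variable {n : ℕ}

/-- The map `x` is affine on each block whose words all have length at least `K`, and the words of
the image are longer by at most `K`. -/
def BlockBound (x : Cube n → Cube n) (K : ℕ) : Prop :=
  ∀ b : Block n, (∀ i, K ≤ (b i).length) →
    ∃ c, MapsBlock x b c ∧ ∀ i, (c i).length ≤ (b i).length + K

theorem BlockBound.mono {x : Cube n → Cube n} {K L : ℕ} (hx : BlockBound x K) (h : K ≤ L) :
    BlockBound x L := fun b hb =>
  let ⟨c, hc, hl⟩ := hx b fun i => h.trans (hb i)
  ⟨c, hc, fun i => (hl i).trans (by omega)⟩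

theorem exists_blockBound (x : nV n) : ∃ K, BlockBound (x : Equiv.Perm (Cube n)) K := by
  obtain ⟨t, ht⟩ := x.2
  obtain ⟨K, hK⟩ := DTree.exists_bound ht
  refine ⟨t.carets + K, fun b hb => ?_⟩
  obtain ⟨c, hc, w, rfl⟩ := t.exists_leaf_prefix b fun i => (Nat.le_add_right _ _).trans (hb i)
  obtain ⟨d, hd, hlen⟩ := hK c hc
  refine ⟨_, hd.append w, fun i => ?_⟩
  have := hlen i
  simp only [List.length_append]
  omega

theorem exists_blockBound_of_finite {S : Set (nV n)} (hS : S.Finite) :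
    ∃ K, ∀ g : nV n, g ∈ S ∨ g⁻¹ ∈ S → BlockBound (g : Equiv.Perm (Cube n)) K := by
  choose K hK using exists_blockBound (n := n)
  obtain ⟨B, hB⟩ := ((hS.image K).union (hS.image fun g => K g⁻¹)).bddAbove
  refine ⟨B, fun g hg => (hK g).mono (hB (hg.imp (fun h => ⟨g, h, rfl⟩) fun h => ⟨g⁻¹, h, ?_⟩))⟩
  simp only [inv_inv]

theorem BlockBound.exists_coarser {x : Cube n → Cube n} {K : ℕ} (hx : BlockBound x K)
    {g c : Block n} (h : MapsBlock x g c) {w : Block n} (hw : ∀ j, K ≤ (w j).length) :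
    ∃ β β' v : Block n, MapsBlock x β β' ∧ (∀ j, (β j).length = K) ∧
      (∀ j, (β' j).length ≤ 2 * K) ∧ β.cat v = g.cat w ∧ β'.cat v = c.cat w := by
  let β : Block n := fun j => (g.cat w j).take K
  let v : Block n := fun j => (g.cat w j).drop K
  have hβ (j : Fin n) : (β j).length = K := by
    simpa [β] using (hw j).trans (Nat.le_add_left _ _)
  have hcat : β.cat v = g.cat w := funext fun j => List.take_append_drop K _
  obtain ⟨β', hm, hlen⟩ := hx β fun j => (hβ j).ge
  refine ⟨β, β', v, hm, hβ, fun j => ?_, hcat, (hcat ▸ hm.cat v).target_unique (h.cat w)⟩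
  rw [two_mul]
  simpa only [hβ] using hlen j

theorem BlockBound.length_le {x : Cube n → Cube n} {K : ℕ} (hx : BlockBound x K) {g c : Block n}
    (h : MapsBlock x g c) (i : Fin n) : (g i).length ≤ (c i).length + K := by
  obtain ⟨β, β', v, -, hβ, -, hg, hc⟩ :=
    hx.exists_coarser h (w := fun _ => List.replicate K false) (by simp)
  have hg := congrArg List.length (congrFun hg i)
  have hc := congrArg List.length (congrFun hc i)
  simp only [Block.cat_apply, List.length_append, hβ, List.length_replicate] at hg hc
  omega

theorem BlockBound.one : BlockBound (1 : Equiv.Perm (Cube n)) 0 :=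
  fun b _ => ⟨b, fun _ => rfl, fun _ => le_rfl⟩

theorem BlockBound.mul {x y : Equiv.Perm (Cube n)} {K L : ℕ} (hx : BlockBound x K)
    (hy : BlockBound y L) : BlockBound (x * y : Equiv.Perm (Cube n)) (K + L) := by
  intro b hb
  obtain ⟨c, hc, hbc⟩ := hy b fun i => (Nat.le_add_left _ _).trans (hb i)
  obtain ⟨d, hd, hcd⟩ := hx c fun i => by
    have := hy.length_le hc i
    have := hb i
    omega
  refine ⟨d, hc.trans hd, fun i => ?_⟩
  have := hbc i
  have := hcd i
  omega

theorem BlockBound.list_prod {K : ℕ} {w : List (nV n)}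
    (hw : ∀ g ∈ w, BlockBound (g : Equiv.Perm (Cube n)) K) :
    BlockBound (w.prod : Equiv.Perm (Cube n)) (K * w.length) := by
  induction w with
  | nil => exact BlockBound.one
  | cons g w ih =>
    rw [List.forall_mem_cons] at hw
    rw [List.prod_cons, Subgroup.coe_mul, List.length_cons, Nat.mul_succ, add_comm]
    exact hw.1.mul (ih hw.2)

end BlockBound

/-! ### Enlarging a block -/

section Enlarge

variable {n : ℕ}

/-- The block that is the interval `r` in direction `i` and has full extent in all other
directions. -/
def Block.single (i : Fin n) (r : List Bool) : Block n := Function.update Block.root i r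

@[simp] theorem Block.single_self (i : Fin n) (r : List Bool) : Block.single i r i = r := by
  simp [Block.single]

@[simp] theorem Block.single_of_ne {i j : Fin n} (h : j ≠ i) (r : List Bool) :
    Block.single i r j = [] := by
  simp [Block.single, h]

theorem Block.cat_right_cancel {b c w : Block n} (h : b.cat w = c.cat w) : b = c :=
  funext fun i => List.append_cancel_right (congrFun h i)

theorem MapsBlock.of_leaves {f : Cube n → Cube n} {b c : Block n} (t : DTree n)
    (h : ∀ w ∈ t.leaves, MapsBlock f (b.cat w) (c.cat w)) : MapsBlock f b c := by
  intro s
  obtain ⟨w, hw, s, rfl⟩ := t.exists_leaf_embed s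
  rw [← Block.embed_cat, ← Block.embed_cat, h w hw]

theorem BlockBound.exists_enlarge_cat {x : Cube n → Cube n} {K : ℕ} (hx : BlockBound x K)
    {g N w : Block n} {i : Fin n} {r : List Bool} (hN : 2 * K ≤ (N i).length)
    (h : MapsBlock x g (N.cat (Block.single i r))) (hwi : w i = [])
    (hw : ∀ j ≠ i, K ≤ (w j).length) :
    ∃ g' : Block n, g = g'.cat (Block.single i r) ∧ (g' i).length ≤ (N i).length + K ∧
      MapsBlock x (g'.cat w) (N.cat w) := by
  have hw' (j : Fin n) : K ≤ (w.cat (Block.single i (List.replicate K false)) j).length := by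
    obtain rfl | hj := eq_or_ne j i
    · simp
    · simpa [hj] using hw j hj
  obtain ⟨β, β', v, hm, hβ, hβ', hg, hc⟩ := hx.exists_coarser h hw'
  have hgi := congrFun hg i
  have hci := congrFun hc i
  simp only [Block.cat_apply, Block.single_self, hwi, List.nil_append, List.append_assoc] at hgi hci
  obtain ⟨m, hNm⟩ : β' i <+: N i := List.prefix_of_prefix_length_le (List.prefix_append _ _)
    (hci.symm ▸ List.prefix_append _ _) ((hβ' i).trans hN)
  rw [← hNm, List.append_assoc, List.append_cancel_left_eq] at hci
  rw [hci, ← List.append_assoc, ← List.append_assoc, List.append_cancel_right_eq] at hgi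
  let g' : Block n := Function.update g i (β i ++ m)
  have hcat : g'.cat w = β.cat (Function.update v i m) := by
    funext j
    obtain rfl | hj := eq_or_ne j i
    · simp [g', hwi]
    · simpa [g', hj] using (congrFun hg j).symm
  have hcat' : N.cat w = β'.cat (Function.update v i m) := by
    funext j
    obtain rfl | hj := eq_or_ne j i
    · simp [hwi, hNm]
    · simpa [hj] using (congrFun hc j).symm
  refine ⟨g', funext fun j => ?_, ?_, hcat ▸ hcat' ▸ hm.cat _⟩
  · obtain rfl | hj := eq_or_ne j i
    · simp [g', hgi]
    · simp [g', hj]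
  · simp only [g', Function.update_self, ← hNm, List.length_append, hβ]
    omega

theorem BlockBound.exists_enlarge {x : Cube n → Cube n} {K : ℕ} (hx : BlockBound x K)
    {g N : Block n} {i : Fin n} {r : List Bool} (hN : 2 * K ≤ (N i).length)
    (h : MapsBlock x g (N.cat (Block.single i r))) :
    ∃ g' : Block n, g = g'.cat (Block.single i r) ∧ (g' i).length ≤ (N i).length + K ∧
      MapsBlock x g' N := by
  let t : DTree n := gridTree (Function.update (fun _ => BTree.full K) i .leaf)
  have enlarge {w : Block n} (hw : w ∈ t.leaves) := by
    rw [mem_leaves_gridTree] at hw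
    exact hx.exists_enlarge_cat hN h (w := w) (by simpa [BTree.words] using hw i) fun j hj => by
      have := hw j
      rw [Function.update_of_ne hj, BTree.mem_words_full] at this
      exact this.ge
  obtain ⟨w, hw⟩ := List.exists_mem_of_ne_nil _ t.leaves_ne_nil
  obtain ⟨g', hg, hlen, -⟩ := enlarge hw
  refine ⟨g', hg, hlen, .of_leaves t fun w hw => ?_⟩
  obtain ⟨g'', hg', -, hm⟩ := enlarge hw
  rwa [Block.cat_right_cancel (hg.symm.trans hg')]

end Enlarge

/-! ### Erasing deep carets -/

section Erase

variable {n : ℕ}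

/-- `T.EraseAt t' u`: the tree `t'` arises from `T` by erasing the exposed caret whose root has the
word `u`. -/
inductive BTree.EraseAt : BTree → BTree → List Bool → Prop
  | exposed : BTree.EraseAt (.caret .leaf .leaf) .leaf []
  | left {l l' : BTree} {u : List Bool} (r : BTree) (h : BTree.EraseAt l l' u) :
      BTree.EraseAt (.caret l r) (.caret l' r) (false :: u)
  | right (l : BTree) {r r' : BTree} {u : List Bool} (h : BTree.EraseAt r r' u) :
      BTree.EraseAt (.caret l r) (.caret l r') (true :: u)

section BTree

variable {T t' : BTree} {u : List Bool}

theorem BTree.EraseAt.erase (h : T.EraseAt t' u) : T.Erase t' := by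
  induction h with
  | exposed => exact .exposed
  | left r _ ih => exact .left r ih
  | right l _ ih => exact .right l ih

theorem BTree.EraseAt.mem_words (h : T.EraseAt t' u) : u ∈ t'.words := by
  induction h with
  | exposed => simp [BTree.words]
  | left r _ ih => simpa [BTree.words] using ih
  | right l _ ih => simpa [BTree.words] using ih

theorem BTree.EraseAt.mem_words_or_eq_append (h : T.EraseAt t' u) {v : List Bool}
    (hv : v ∈ T.words) : v ∈ t'.words ∨ ∃ a, v = u ++ [a] := by
  induction h generalizing v with
  | exposed => exact .inr (by simpa [BTree.words] using hv)
  | left r _ ih =>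
    simp only [BTree.words, List.mem_append, List.mem_map] at hv ⊢
    obtain ⟨v, hv, rfl⟩ | hv := hv
    · exact (ih hv).imp (fun h => .inl ⟨v, h, rfl⟩) fun ⟨a, h⟩ => ⟨a, congrArg _ h⟩
    · exact .inl (.inr hv)
  | right l _ ih =>
    simp only [BTree.words, List.mem_append, List.mem_map] at hv ⊢
    obtain hv | ⟨v, hv, rfl⟩ := hv
    · exact .inl (.inl hv)
    · exact (ih hv).imp (fun h => .inr ⟨v, h, rfl⟩) fun ⟨a, h⟩ => ⟨a, congrArg _ h⟩

theorem BTree.EraseAt.mem_words_of_length_le (h : T.EraseAt t' u) {v : List Bool}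
    (hv : v ∈ T.words) (hlen : v.length ≤ u.length) : v ∈ t'.words := by
  refine (h.mem_words_or_eq_append hv).resolve_right ?_
  rintro ⟨a, rfl⟩
  simp at hlen

theorem BTree.EraseAt.exists_append_mem_words (h : T.EraseAt t' u) {z w : List Bool}
    (hz : z ++ w ∈ T.words) (hlen : z.length ≤ u.length) : ∃ w', z ++ w' ∈ t'.words := by
  obtain hmem | ⟨a, ha⟩ := h.mem_words_or_eq_append hz
  · exact ⟨w, hmem⟩
  · obtain ⟨w', rfl⟩ : z <+: u := List.prefix_of_prefix_length_le (ha ▸ List.prefix_append z w)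
      (List.prefix_append u [a]) hlen
    exact ⟨w', h.mem_words⟩

theorem BTree.exists_eraseAt {T : BTree} (hT : T ≠ .leaf) : ∃ t' u, T.EraseAt t' u := by
  induction T with
  | leaf => exact absurd rfl hT
  | caret l r ihl ihr =>
    by_cases hl : l = .leaf
    · by_cases hr : r = .leaf
      · subst hl hr
        exact ⟨_, _, .exposed⟩
      · obtain ⟨t', u, h⟩ := ihr hr
        exact ⟨_, _, h.right l⟩
    · obtain ⟨t', u, h⟩ := ihl hl
      exact ⟨_, _, h.left r⟩

theorem BTree.exists_eraseAt_length_le {T : BTree} {w : List Bool} (hw : w ∈ T.words)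
    (hne : w ≠ []) : ∃ t' u, T.EraseAt t' u ∧ w.length ≤ u.length + 1 := by
  induction T generalizing w with
  | leaf => exact absurd (List.mem_singleton.1 hw) hne
  | caret l r ihl ihr =>
    obtain ⟨a, w, rfl⟩ := List.exists_cons_of_ne_nil hne
    obtain rfl | hw' := eq_or_ne w []
    · obtain ⟨t', u, h⟩ := BTree.exists_eraseAt (T := .caret l r) nofun
      exact ⟨t', u, h, by simp⟩
    · cases a
      · obtain ⟨t', u, h, hlen⟩ := ihl (by simpa [BTree.words] using hw) hw'
        exact ⟨_, _, h.left r, by simpa using hlen⟩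
      · obtain ⟨t', u, h, hlen⟩ := ihr (by simpa [BTree.words] using hw) hw'
        exact ⟨_, _, h.right l, by simpa using hlen⟩

theorem BTree.exists_subtree {T : BTree} {z w : List Bool} (h : z ++ w ∈ T.words) :
    ∃ t : BTree, ∀ v ∈ t.words, z ++ v ∈ T.words := by
  induction z generalizing T with
  | nil => exact ⟨T, fun v hv => hv⟩
  | cons a z ih =>
    rcases T with _ | ⟨l, r⟩
    · simp [BTree.words] at h
    · cases a
      · obtain ⟨t, ht⟩ := ih (T := l) (by simpa [BTree.words] using h)
        exact ⟨t, fun v hv => by simpa [BTree.words] using ht v hv⟩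
      · obtain ⟨t, ht⟩ := ih (T := r) (by simpa [BTree.words] using h)
        exact ⟨t, fun v hv => by simpa [BTree.words] using ht v hv⟩

end BTree

/-- The subdivision that `t` induces on the lower face of the cube in direction `i`. -/
def DTree.slice (i : Fin n) : DTree n → DTree n
  | .leaf => .leaf
  | .caret j l r => if j = i then l.slice i else .caret j (l.slice i) (r.slice i)

theorem DTree.exists_cat_single_mem_leaves {i : Fin n} {t : DTree n} {R : Block n}
    (hR : R ∈ (t.slice i).leaves) :
    R i = [] ∧ ∃ r, R.cat (Block.single i r) ∈ t.leaves := by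
  induction t generalizing R with
  | leaf =>
    obtain rfl := List.mem_singleton.1 hR
    exact ⟨rfl, [], List.mem_singleton.2 (Function.update_eq_self i Block.root)⟩
  | caret j l r ihl ihr =>
    rw [DTree.slice] at hR
    simp only [DTree.leaves, List.mem_append]
    split_ifs at hR with hj
    · subst hj
      obtain ⟨hRj, r, hr⟩ := ihl hR
      refine ⟨hRj, false :: r, .inl (List.mem_map.2 ⟨_, hr, ?_⟩)⟩
      funext k
      by_cases hk : k = j
      · subst hk; simp [Block.inHalf_self, hRj]
      · simp [Block.inHalf_of_ne hk, hk]
    · have hij : i ≠ j := Ne.symm hj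
      simp only [DTree.leaves, List.mem_append, List.mem_map] at hR
      rcases hR with ⟨R, hR, rfl⟩ | ⟨R, hR, rfl⟩
      · obtain ⟨hRi, r, hr⟩ := ihl hR
        rw [Block.inHalf_of_ne hij]
        exact ⟨hRi, r, .inl (Block.inHalf_cat j _ R _ ▸ List.mem_map_of_mem hr)⟩
      · obtain ⟨hRi, r, hr⟩ := ihr hR
        rw [Block.inHalf_of_ne hij]
        exact ⟨hRi, r, .inr (Block.inHalf_cat j _ R _ ▸ List.mem_map_of_mem hr)⟩

variable {x : Cube n → Cube n} {K : ℕ} {T : Fin n → BTree} {i : Fin n} {t' : BTree}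
  {u : List Bool} {N : Block n}

theorem mem_leaves_gridTree_update {g : Block n} :
    g ∈ (gridTree (Function.update T i t')).leaves ↔
      g i ∈ t'.words ∧ ∀ j ≠ i, g j ∈ (T j).words := by
  rw [mem_leaves_gridTree, Function.forall_update_iff T fun j t => g j ∈ t.words]

theorem TiledByImages.eraseAt_of_length_eq (h : TiledByImages x T N) (hx : BlockBound x K)
    (he : (T i).EraseAt t' u) (hu : 3 * K ≤ u.length) (hN : (N i).length = 2 * K) :
    TiledByImages x (Function.update T i t') N := by
  obtain ⟨t, ht⟩ := h
  refine .of_leaves (t.slice i) fun R hR => ?_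
  obtain ⟨hRi, r, hr⟩ := DTree.exists_cat_single_mem_leaves hR
  obtain ⟨g, hg, hm⟩ := ht _ hr
  have hNR : (N.cat R i).length = 2 * K := by simp [hRi, hN]
  rw [← Block.cat_assoc] at hm
  obtain ⟨g', rfl, hlen, hm'⟩ := hx.exists_enlarge hNR.ge hm
  rw [mem_leaves_gridTree] at hg
  obtain ⟨w, hw⟩ := he.exists_append_mem_words (hg i) (by omega)
  obtain ⟨τ, hτ⟩ := BTree.exists_subtree hw
  refine .of_mapsBlock hm' (τ.hang i .leaf) fun d hd => ?_
  obtain ⟨v, hv, c, hc, rfl⟩ := BTree.mem_leaves_hang.1 hd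
  obtain rfl := List.mem_singleton.1 hc
  rw [mem_leaves_gridTree_update]
  exact ⟨by simpa using hτ v hv, fun j hj => by simpa [hj] using hg j⟩

theorem TiledByImages.eraseAt (h : TiledByImages x T N) (hx : BlockBound x K)
    (he : (T i).EraseAt t' u) (hu : 3 * K ≤ u.length) (hN : (N i).length ≤ 2 * K) :
    TiledByImages x (Function.update T i t') N := by
  obtain ⟨t, ht⟩ := h
  induction t generalizing N with
  | leaf =>
    obtain ⟨g, hg, hm⟩ := ht Block.root (List.mem_singleton.2 rfl)
    rw [Block.cat_root] at hm
    rw [mem_leaves_gridTree] at hg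
    have hlen := hx.length_le hm i
    refine .of_mapsBlock hm .leaf fun c hc => ?_
    obtain rfl := List.mem_singleton.1 hc
    change g.cat Block.root ∈ _
    rw [Block.cat_root, mem_leaves_gridTree_update]
    exact ⟨he.mem_words_of_length_le (hg i) (by omega), fun j _ => hg j⟩
  | caret j l r ihl ihr =>
    obtain hN' | hN' := hN.eq_or_lt
    · exact eraseAt_of_length_eq ⟨_, ht⟩ hx he hu hN'
    · have hNa (a : Bool) : (N.cat (Block.root.inHalf j a) i).length ≤ 2 * K := by
        obtain rfl | hij := eq_or_ne i j
        · simpa [Block.inHalf_self] using hN'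
        · simpa [Block.inHalf_of_ne hij] using hN
      refine .of_halves j (Bool.rec (ihl (hNa _) fun c hc => ?_) (ihr (hNa _) fun c hc => ?_)) <;>
        rw [Block.cat_assoc, ← Block.inHalf_eq_cat]
      · exact ht _ (List.mem_append_left _ (List.mem_map_of_mem hc))
      · exact ht _ (List.mem_append_right _ (List.mem_map_of_mem hc))

theorem GridDiagram.IsReducedFor.length_le {x : Equiv.Perm (Cube n)} {D : GridDiagram n}
    (hD : D.IsReducedFor x) (hx : BlockBound x K) {w : List Bool}
    (hw : w ∈ (D.coords i).words) : w.length ≤ 3 * K + 1 := by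
  by_contra! hlt
  obtain ⟨t', u, he, hlen⟩ :=
    BTree.exists_eraseAt_length_le hw (List.ne_nil_of_length_pos (by omega))
  have htiled : TiledByImages x D.coords Block.root := exists_gridDiagram_iff.1 ⟨D, rfl, hD.1⟩
  exact hD.2 i t' he.erase (exists_gridDiagram_iff.2
    (htiled.eraseAt hx he (by omega) (by simp)))

theorem GridDiagram.IsReducedFor.carets_le {x : Equiv.Perm (Cube n)} {D : GridDiagram n}
    (hD : D.IsReducedFor x) (hx : BlockBound x K) : D.carets ≤ 2 ^ (n * (3 * K + 1)) := by
  have h := length_leaves_gridTree_le_two_pow fun i w hw => hD.length_le hx (i := i) (w := w) hw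
  rw [DTree.length_leaves] at h
  exact (Nat.le_succ _).trans h

end Erase

/-! ### Brin's generators -/

section Brin

variable {n : ℕ} {α κ : Type*}

theorem finite_brinGenerators : brinGenerators.Finite := by
  have hunion : brinGenerators =
      ⋃ D ∈ {D | D ∈ brinDiagrams}, {g : nV 2 | D.Represents (g : Equiv.Perm (Cube 2))} := by
    ext g
    simp [brinGenerators]
  rw [hunion]
  refine (List.finite_toSet _).biUnion fun D _ => Set.Subsingleton.finite fun g hg g' hg' => ?_
  refine Subtype.ext (perm_eq_of_mapsBlock D.source fun b hb => ?_)
  obtain ⟨j, rfl⟩ := List.get_of_mem hb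
  exact ⟨_, hg j, hg' j⟩

/-- Some element of the subgroup generated by Brin's generators carries the subdivision given by
the first labelled tree to that given by the second one. -/
def BrinConn (T T' : LTree 2 α) : Prop :=
  ∃ x ∈ Subgroup.closure brinGenerators, Carries (x : Equiv.Perm (Cube 2)) T.leaves T'.leaves

section

variable {T T' T'' : LTree 2 α}

theorem BrinConn.of_leaves_perm (h : T.leaves.Perm T'.leaves) : BrinConn T T' :=
  ⟨1, one_mem _, .of_perm h⟩

theorem BrinConn.trans (h : BrinConn T T') (h' : BrinConn T' T'') : BrinConn T T'' :=
  let ⟨x, hx, hcarries⟩ := h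
  let ⟨y, hy, hcarries'⟩ := h'
  ⟨y * x, mul_mem hy hx, hcarries.trans hcarries'⟩

theorem BrinConn.symm (h : BrinConn T T') : BrinConn T' T :=
  let ⟨x, hx, hcarries⟩ := h
  ⟨x⁻¹, inv_mem hx, hcarries.symm⟩

theorem BrinConn.bind {e e' : LTree 2 κ} (f : κ → LTree 2 α)
    (h : BrinConn (e.prune fun j => !(f j).leaves.isEmpty)
      (e'.prune fun j => !(f j).leaves.isEmpty)) : BrinConn (e.bind f) (e'.bind f) :=
  let ⟨x, hx, hcarries⟩ := h
  ⟨x, hx, hcarries.bind f⟩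

theorem BrinConn.of_diagram {D : TreePair 2} (hD : D ∈ brinDiagrams) (hnd : T.labels.Nodup)
    (hperm : T.labels.Perm T'.labels)
    (hleaves : ∀ j, ∃ a, (D.source.leaves.get j, a) ∈ T.leaves ∧
      (D.target.leaves.get (D.perm j), a) ∈ T'.leaves) : BrinConn T T' := by
  obtain ⟨x, hx⟩ := exists_carries hnd hperm
  refine ⟨x, Subgroup.subset_closure ⟨D, hD, fun j => ?_⟩, hx⟩
  obtain ⟨a, hsource, htarget⟩ := hleaves j
  obtain ⟨q, hq, hqa, hmaps⟩ := hx.1 _ hsource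
  obtain rfl : q = _ := LTree.eq_of_snd_eq (hperm.nodup_iff.1 hnd) hq htarget hqa
  exact hmaps

end

theorem brinConn_split_zero (d : Fin 2) :
    BrinConn (.node 0 (.node d (.leaf 1) (.leaf 2)) (.leaf 3) : LTree 2 (Fin 4))
      (.node 0 (.leaf 1) (.node 0 (.leaf 2) (.leaf 3))) := by
  refine .of_diagram (D := splitDiagram d 0) ?_ (by decide +revert) (by decide +revert)
    (by decide +revert)
  fin_cases d <;> simp [brinDiagrams]

theorem brinConn_split_one (d : Fin 2) :
    BrinConn (.node 0 (.leaf 0) (.node 0 (.node d (.leaf 1) (.leaf 2)) (.leaf 3)) :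
        LTree 2 (Fin 4))
      (.node 0 (.leaf 0) (.node 0 (.leaf 1) (.node 0 (.leaf 2) (.leaf 3)))) := by
  refine .of_diagram (D := splitDiagram d 1) ?_ (by decide +revert) (by decide +revert)
    (by decide +revert)
  fin_cases d <;> simp [brinDiagrams]

theorem brinConn_swap_zero :
    BrinConn (.node 0 (.leaf 1) (.node 0 (.leaf 2) (.leaf 3)) : LTree 2 (Fin 4))
      (.node 0 (.leaf 2) (.node 0 (.leaf 1) (.leaf 3))) :=
  .of_diagram (D := swapDiagram 2 0 (by norm_num)) (by simp [brinDiagrams]) (by decide)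
    (by decide) (by decide)

theorem brinConn_swap_one :
    BrinConn (.node 0 (.leaf 0) (.node 0 (.leaf 1) (.node 0 (.leaf 2) (.leaf 3))) :
        LTree 2 (Fin 4))
      (.node 0 (.leaf 0) (.node 0 (.leaf 2) (.node 0 (.leaf 1) (.leaf 3)))) :=
  .of_diagram (D := swapDiagram 3 1 (by norm_num)) (by simp [brinDiagrams]) (by decide)
    (by decide) (by decide)

theorem brinConn_swapLast_zero :
    BrinConn (.node 0 (.leaf 1) (.leaf 2) : LTree 2 (Fin 4)) (.node 0 (.leaf 2) (.leaf 1)) :=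
  .of_diagram (D := swapDiagram 1 0 (by norm_num)) (by simp [brinDiagrams]) (by decide)
    (by decide) (by decide)

theorem brinConn_swapLast_one :
    BrinConn (.node 0 (.leaf 0) (.node 0 (.leaf 1) (.leaf 2)) : LTree 2 (Fin 4))
      (.node 0 (.leaf 0) (.node 0 (.leaf 2) (.leaf 1))) :=
  .of_diagram (D := swapDiagram 2 1 (by norm_num)) (by simp [brinDiagrams]) (by decide)
    (by decide) (by decide)

/-- The two trees are connected behind any, possibly void, subtree `z`. This strengthening of
`BrinConn` persists when both trees are placed inside a larger one, see `BrinTailConn.left` and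
`BrinTailConn.right`. -/
def BrinTailConn (T T' : LTree 2 α) : Prop := ∀ z, BrinConn (.node 0 z T) (.node 0 z T')

namespace BrinTailConn

variable {T T' T'' : LTree 2 α}

theorem brinConn (h : BrinTailConn T T') : BrinConn T T' := h .nil

theorem of_leaves_perm (h : T.leaves.Perm T'.leaves) : BrinTailConn T T' := by
  refine fun z => BrinConn.of_leaves_perm ?_
  simp only [LTree.leaves]
  by_cases hz : z.leaves = []
  · simpa [hz] using h
  by_cases hT : T.leaves = []
  · rw [hT] at h ⊢
    rw [h.nil_eq]
  have hT' : T'.leaves ≠ [] := fun hnil => hT (hnil ▸ h).eq_nil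
  rw [joinLeaves_of_ne_nil 0 hz hT, joinLeaves_of_ne_nil 0 hz hT']
  exact (h.map _).append_left _

theorem of_leaves_eq (h : T.leaves = T'.leaves) : BrinTailConn T T' := .of_leaves_perm (.of_eq h)

theorem trans (h : BrinTailConn T T') (h' : BrinTailConn T' T'') : BrinTailConn T T'' :=
  fun z => (h z).trans (h' z)

theorem symm (h : BrinTailConn T T') : BrinTailConn T' T := fun z => (h z).symm

theorem split (d : Fin 2) (a b c : LTree 2 α) (hc : c.leaves ≠ []) :
    BrinTailConn (.node 0 (.node d a b) c) (.node 0 a (.node 0 b c)) := by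
  by_cases ha : a.leaves = []
  · exact .of_leaves_eq (by simp [LTree.leaves, ha])
  by_cases hb : b.leaves = []
  · exact .of_leaves_eq (by simp [LTree.leaves, hb])
  intro z
  refine BrinConn.bind (e := .node 0 (.leaf 0) (.node 0 (.node d (.leaf 1) (.leaf 2)) (.leaf 3)))
    (e' := .node 0 (.leaf 0) (.node 0 (.leaf 1) (.node 0 (.leaf 2) (.leaf 3)))) ![z, a, b, c] ?_
  by_cases hz : z.leaves = []
  · simpa [BrinConn, LTree.leaves, LTree.prune, ha, hb, hc, hz] using brinConn_split_zero d
  · simpa [BrinConn, LTree.leaves, LTree.prune, ha, hb, hc, hz] using brinConn_split_one d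

theorem assoc (a b c : LTree 2 α) :
    BrinTailConn (.node 0 (.node 0 a b) c) (.node 0 a (.node 0 b c)) := by
  by_cases hc : c.leaves = []
  · exact .of_leaves_eq (by simp [LTree.leaves, hc])
  · exact split 0 a b c hc

theorem swap (a b c : LTree 2 α) :
    BrinTailConn (.node 0 a (.node 0 b c)) (.node 0 b (.node 0 a c)) := by
  by_cases ha : a.leaves = []
  · exact .of_leaves_eq (by simp [LTree.leaves, ha])
  by_cases hb : b.leaves = []
  · exact .of_leaves_eq (by simp [LTree.leaves, hb])
  intro z
  refine BrinConn.bind (e := .node 0 (.leaf 0) (.node 0 (.leaf 1) (.node 0 (.leaf 2) (.leaf 3))))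
    (e' := .node 0 (.leaf 0) (.node 0 (.leaf 2) (.node 0 (.leaf 1) (.leaf 3)))) ![z, a, b, c] ?_
  by_cases hz : z.leaves = [] <;> by_cases hc : c.leaves = []
  · simpa [BrinConn, LTree.leaves, LTree.prune, ha, hb, hc, hz] using brinConn_swapLast_zero
  · simpa [BrinConn, LTree.leaves, LTree.prune, ha, hb, hc, hz] using brinConn_swap_zero
  · simpa [BrinConn, LTree.leaves, LTree.prune, ha, hb, hc, hz] using brinConn_swapLast_one
  · simpa [BrinConn, LTree.leaves, LTree.prune, ha, hb, hc, hz] using brinConn_swap_one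

theorem comm (a b : LTree 2 α) : BrinTailConn (.node 0 a b) (.node 0 b a) :=
  (of_leaves_eq (by simp [LTree.leaves])).trans
    ((swap a b .nil).trans (of_leaves_eq (by simp [LTree.leaves])))

theorem right (h : BrinTailConn T T') (y : LTree 2 α) :
    BrinTailConn (.node 0 y T) (.node 0 y T') := fun z =>
  (assoc z y T).brinConn.symm.trans ((h (.node 0 z y)).trans (assoc z y T').brinConn)

theorem left (h : BrinTailConn T T') (y : LTree 2 α) :
    BrinTailConn (.node 0 T y) (.node 0 T' y) :=
  (comm T y).trans ((h.right y).trans (comm y T'))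

end BrinTailConn

theorem LTree.prune_eq_self {m : α → Bool} (hm : ∀ a, m a) (T : LTree n α) : T.prune m = T := by
  induction T with
  | nil => rfl
  | leaf a => simp [LTree.prune, hm a]
  | node i l r ihl ihr => rw [LTree.prune, ihl, ihr]

theorem LTree.mem_leaves_bind_ofDTree {e : LTree n κ} {t : DTree n}
    {r : Block n × (κ × Block n)} :
    r ∈ (e.bind fun a => .ofDTree (Prod.mk a) t).leaves ↔
      ∃ p ∈ e.leaves, ∃ b ∈ t.leaves, (p.1.cat b, (p.2, b)) = r := by
  rw [LTree.leaves_bind, LTree.prune_eq_self, mem_substLeaves]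
  · simp [LTree.leaves_ofDTree]
  · simpa [LTree.leaves_ofDTree] using fun _ => t.leaves_ne_nil

theorem Carries.of_bind_ofDTree {x : Equiv.Perm (Cube n)} {e e' : LTree n κ}
    (hnd : e'.labels.Nodup) (t : DTree n)
    (h : Carries x (e.bind fun a => .ofDTree (Prod.mk a) t).leaves
      (e'.bind fun a => .ofDTree (Prod.mk a) t).leaves) : Carries x e.leaves e'.leaves := by
  have mapsBlock (p) (hp : p ∈ e.leaves) (q) (hq : q ∈ e'.leaves) (hqp : q.2 = p.2) :
      MapsBlock x p.1 q.1 := by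
    refine MapsBlock.of_leaves t fun b hb => ?_
    obtain ⟨r, hr, hrp, hmaps⟩ := h.1 _ (LTree.mem_leaves_bind_ofDTree.2 ⟨p, hp, b, hb, rfl⟩)
    obtain ⟨q', hq', b', -, rfl⟩ := LTree.mem_leaves_bind_ofDTree.1 hr
    obtain ⟨hqp', rfl⟩ := Prod.mk.inj hrp
    obtain rfl : q' = q := LTree.eq_of_snd_eq hnd hq' hq (hqp'.trans hqp.symm)
    exact hmaps
  obtain ⟨b, hb⟩ := List.exists_mem_of_ne_nil _ t.leaves_ne_nil
  constructor
  · intro p hp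
    obtain ⟨r, hr, hrp, -⟩ := h.1 _ (LTree.mem_leaves_bind_ofDTree.2 ⟨p, hp, b, hb, rfl⟩)
    obtain ⟨q, hq, b', -, rfl⟩ := LTree.mem_leaves_bind_ofDTree.1 hr
    have hqp : q.2 = p.2 := (Prod.mk.inj hrp).1
    exact ⟨q, hq, hqp, mapsBlock p hp q hq hqp⟩
  · intro q hq
    obtain ⟨r, hr, hqr, -⟩ := h.2 _ (LTree.mem_leaves_bind_ofDTree.2 ⟨q, hq, b, hb, rfl⟩)
    obtain ⟨p, hp, b', -, rfl⟩ := LTree.mem_leaves_bind_ofDTree.1 hr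
    have hqp : q.2 = p.2 := (Prod.mk.inj hqr).1
    exact ⟨p, hp, hqp, mapsBlock p hp q hq hqp⟩

namespace BrinTailConn

-- Cutting a square into quarters does not depend on the order of the two cuts.
theorem turn_refined (p₀ p₁ q₀ q₁ : α) :
    BrinTailConn (.node 1 (.node 0 (.leaf p₀) (.leaf p₁)) (.node 0 (.leaf q₀) (.leaf q₁)))
      (.node 0 (.node 0 (.leaf p₀) (.leaf p₁)) (.node 0 (.leaf q₀) (.leaf q₁))) := by
  have leaves_ne_nil (a : α) : (LTree.leaf a : LTree 2 α).leaves ≠ [] := by simp [LTree.leaves]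
  have quarters : BrinTailConn
      (.node 1 (.node 0 (.leaf p₀) (.leaf p₁)) (.node 0 (.leaf q₀) (.leaf q₁)))
      (.node 0 (.node 1 (.leaf p₀) (.leaf q₀)) (.node 1 (.leaf p₁) (.leaf q₁))) := by
    refine .of_leaves_perm ?_
    have inHalf_comm (a b : Bool) (w : Block 2) :
        (w.inHalf 0 a).inHalf 1 b = (w.inHalf 1 b).inHalf 0 a := by
      funext j
      fin_cases j <;> simp [Block.inHalf]
    simp only [LTree.leaves, joinLeaves, List.map_cons, List.map_nil, List.cons_append,
      List.nil_append, Prod.map_apply, id, inHalf_comm]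
    exact (List.Perm.swap _ _ _).cons _
  have open_left := split 1 (.leaf p₀) (.leaf q₀) (.node 1 (.leaf p₁) (.leaf q₁))
    (by simp [LTree.leaves, joinLeaves])
  have bring_right := (comm (.leaf q₀) (.node 1 (.leaf p₁) (.leaf q₁))).right (.leaf p₀)
  have open_right := (split 1 (.leaf p₁) (.leaf q₁) (.leaf q₀) (leaves_ne_nil q₀)).right
    (.leaf p₀)
  have exchange := ((comm (.leaf q₁) (.leaf q₀)).right (.leaf p₁)).right (.leaf p₀)
  have regroup := (assoc (.leaf p₀) (.leaf p₁) (.node 0 (.leaf q₀) (.leaf q₁))).symm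
  exact ((((quarters.trans open_left).trans bring_right).trans open_right).trans exchange).trans
    regroup

theorem turn (d : Fin 2) (a b : LTree 2 α) : BrinTailConn (.node d a b) (.node 0 a b) := by
  obtain rfl | rfl : d = 0 ∨ d = 1 := by omega
  · exact .of_leaves_eq rfl
  by_cases ha : a.leaves = []
  · exact .of_leaves_eq (by simp [LTree.leaves, ha])
  by_cases hb : b.leaves = []
  · exact .of_leaves_eq (by simp [LTree.leaves, hb])
  intro z
  refine BrinConn.bind (e := .node 0 (.leaf 0) (.node 1 (.leaf 1) (.leaf 2)))
    (e' := .node 0 (.leaf 0) (.node 0 (.leaf 1) (.leaf 2)))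
    (![z, a, b] : Fin 3 → LTree 2 α) ?_
  obtain ⟨x, hx, hcarries⟩ := turn_refined (α := Fin 3 × Block 2) _ _ _ _ _
  refine ⟨x, hx, Carries.of_bind_ofDTree ?_ (.caret 0 .leaf .leaf) ?_⟩
  · rw [LTree.labels_prune]
    exact List.Nodup.filter _ (by decide)
  · simpa [LTree.prune, LTree.bind, LTree.ofDTree, ha, hb] using hcarries

theorem comb_append (L M : List α) :
    BrinTailConn (.node 0 (comb L) (comb M)) (comb (L ++ M)) := by
  induction L with
  | nil => exact .of_leaves_eq rfl
  | cons a L ih => exact (assoc _ _ _).trans (ih.right _)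

theorem comb_labels (T : LTree 2 α) : BrinTailConn T (comb T.labels) := by
  induction T with
  | nil => exact .of_leaves_eq rfl
  | leaf a => exact .of_leaves_eq (by simp [LTree.labels, comb, LTree.leaves])
  | node i l r ihl ihr =>
    exact (((turn i l r).trans (ihl.left r)).trans (ihr.right _)).trans (comb_append _ _)

theorem comb_perm {L M : List α} (h : L.Perm M) : BrinTailConn (comb L) (comb M) := by
  induction h with
  | nil => exact .of_leaves_eq rfl
  | cons a _ ih => exact ih.right _
  | swap a b L => exact swap _ _ _
  | trans _ _ ih ih' => exact ih.trans ih'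

theorem of_labels_perm (h : T.labels.Perm T'.labels) : BrinTailConn T T' :=
  ((comb_labels T).trans (comb_perm h)).trans (comb_labels T').symm

end BrinTailConn

theorem closure_brinGenerators : Subgroup.closure brinGenerators = ⊤ := by
  refine eq_top_iff.2 fun x _ => ?_
  obtain ⟨D, hD⟩ := exists_gridDiagram x
  obtain ⟨f, hperm, hcarries⟩ := hD.exists_carries
  obtain ⟨y, hy, hcarries'⟩ := (BrinTailConn.of_labels_perm
    (T := .ofDTree f D.toTreePair.source) (T' := .ofDTree id D.toTreePair.target)
    (by simpa [LTree.labels_ofDTree] using hperm)).brinConn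
  obtain rfl : x = y := Subtype.ext (hcarries.unique_ofDTree hcarries')
  exact hy

end Brin

/-! ### Word length and number of carets -/

section WordLength

variable {n : ℕ} {S : Set (nV n)}

theorem closure_moves (n : ℕ) [NeZero n] : Subgroup.closure (moves n) = ⊤ := by
  refine eq_top_iff.2 fun x _ => ?_
  obtain ⟨D, hD⟩ := exists_gridDiagram x
  obtain ⟨w, hw, rfl, -⟩ := exists_word_of_represents hD Nat.lt_two_pow_self.le
  exact hw.prod_mem_closure

theorem exists_log_carets_le (hS : S.Finite) :
    ∃ C : ℝ, 0 < C ∧ ∀ x ∈ Subgroup.closure S, ∀ D : GridDiagram n,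
      D.IsReducedFor (x : Equiv.Perm (Cube n)) →
        Real.log D.carets ≤ C * wordLength S x + C := by
  obtain ⟨K, hK⟩ := exists_blockBound_of_finite hS
  refine ⟨3 * n * K + n + 1, by positivity, fun x hx D hD => ?_⟩
  obtain ⟨w, hw, rfl, hlen⟩ := exists_isWord_length_eq_wordLength hx
  rw [← hlen]
  set e := n * (3 * (K * w.length) + 1)
  have hcarets : D.carets ≤ 2 ^ e := hD.carets_le (.list_prod fun g hg => hK g (hw g hg))
  have hlog : Real.log D.carets ≤ e := by
    rcases Nat.eq_zero_or_pos D.carets with hzero | hpos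
    · simp [hzero]
    calc Real.log D.carets ≤ Real.log ((2 : ℝ) ^ e) :=
          Real.log_le_log (by exact_mod_cast hpos) (by exact_mod_cast hcarets)
      _ = e * Real.log 2 := Real.log_pow _ _
      _ ≤ e := mul_le_of_le_one_right e.cast_nonneg (by linarith [Real.log_two_lt_d9])
  have he : (e : ℝ) = 3 * n * K * w.length + n := by push_cast [e]; ring
  have hrest : (0 : ℝ) ≤ (n + 1) * w.length + 3 * n * K + 1 := by positivity
  linarith

theorem succ_mul_natLog_le (M : ℕ) :
    ((M + 1) * (2 * (Nat.log 2 M + 1) + 4) : ℝ) ≤ 32 * (M * Real.log M) + 12 := by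
  rcases Nat.lt_or_ge M 2 with hM | hM
  · interval_cases M <;> norm_num
  have hM' : (2 : ℝ) ≤ M := by exact_mod_cast hM
  have hlog_two : (1 / 2 : ℝ) ≤ Real.log 2 := by linarith [Real.log_two_gt_d9]
  have hlog : Real.log 2 ≤ Real.log M := Real.log_le_log (by norm_num) hM'
  have hnatLog : (Nat.log 2 M : ℝ) ≤ 2 * Real.log M := by
    have hle : (Nat.log 2 M : ℝ) * Real.log 2 ≤ Real.log M := by
      rw [← Real.log_pow]
      exact Real.log_le_log (by positivity)
        (by exact_mod_cast Nat.pow_log_le_self 2 (by omega))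
    nlinarith [(Nat.log 2 M).cast_nonneg (α := ℝ)]
  calc ((M + 1) * (2 * (Nat.log 2 M + 1) + 4) : ℝ)
      ≤ (2 * M) * (16 * Real.log M) := by gcongr <;> linarith
    _ ≤ 32 * (M * Real.log M) + 12 := by linarith

theorem exists_wordLength_le_mul_log [NeZero n] (hS : Subgroup.closure S = ⊤) :
    ∃ C : ℝ, ∀ (x : nV n) (D : TreePair n), D.Represents (x : Equiv.Perm (Cube n)) →
      (wordLength S x : ℝ) ≤ C * (D.source.carets * Real.log D.source.carets) + C := by
  obtain ⟨B, hB⟩ := exists_wordLength_prod_le_mul_length (S := S) (finite_moves n) (by simp [hS])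
  refine ⟨32 * B, fun x D hD => ?_⟩
  set M := D.source.carets
  obtain ⟨w, hw, rfl, hlen⟩ := exists_word_of_represents hD (Nat.lt_pow_succ_log_self one_lt_two M)
  have hlen' : (w.length : ℝ) ≤ 32 * (M * Real.log M) + 12 :=
    le_trans (by exact_mod_cast hlen) (succ_mul_natLog_le M)
  calc (wordLength S w.prod : ℝ) ≤ B * w.length := by exact_mod_cast hB w hw
    _ ≤ B * (32 * (M * Real.log M) + 12) := by gcongr
    _ ≤ 32 * B * (M * Real.log M) + 32 * B := by linarith [B.cast_nonneg (α := ℝ)]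

theorem exists_wordLength_bounds [NeZero n] (hS : S.Finite) (hcl : Subgroup.closure S = ⊤) :
    ∃ C : ℝ, 0 < C ∧
      ∀ (x : nV n) (D : GridDiagram n), D.IsReducedFor (x : Equiv.Perm (Cube n)) →
        Real.log D.carets ≤ C * wordLength S x + C ∧
        (wordLength S x : ℝ) ≤ C * (D.carets * Real.log D.carets) + C := by
  obtain ⟨C₁, hC₁, hlog⟩ := exists_log_carets_le hS
  obtain ⟨C₂, hword⟩ := exists_wordLength_le_mul_log hcl
  refine ⟨max C₁ C₂, lt_max_of_lt_left hC₁, fun x D hD => ⟨?_, ?_⟩⟩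
  · refine (hlog x (by simp [hcl]) D hD).trans ?_
    gcongr <;> exact le_max_left _ _
  · have hle : C₂ ≤ max C₁ C₂ := le_max_right _ _
    calc (wordLength S x : ℝ) ≤ C₂ * (D.carets * Real.log D.carets) + C₂ :=
          hword x D.toTreePair hD.1
      _ ≤ max C₁ C₂ * (D.carets * Real.log D.carets) + max C₁ C₂ := by gcongr

end WordLength

end HigherThompson

theorem mainTheorem3 :
    -- Brin's generating set of `2V`
    (Subgroup.closure brinGenerators = ⊤ ∧
      (∀ x : nV 2, ∃ D : GridDiagram 2, D.IsReducedFor (x : Equiv.Perm (Cube 2))) ∧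
      ∃ C : ℝ, 0 < C ∧
        ∀ (x : nV 2) (D : GridDiagram 2), D.IsReducedFor (x : Equiv.Perm (Cube 2)) →
          Real.log D.carets ≤ C * wordLength brinGenerators x + C ∧
          (wordLength brinGenerators x : ℝ) ≤ C * (D.carets * Real.log D.carets) + C) ∧
    -- all `nV`, with respect to any finite generating set
    ∀ n : ℕ, 1 ≤ n →
      Group.FG (nV n) ∧
      (∀ x : nV n, ∃ D : GridDiagram n, D.IsReducedFor (x : Equiv.Perm (Cube n))) ∧
      ∀ S : Set (nV n), S.Finite → Subgroup.closure S = ⊤ →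
        ∃ C : ℝ, 0 < C ∧
          ∀ (x : nV n) (D : GridDiagram n), D.IsReducedFor (x : Equiv.Perm (Cube n)) →
            Real.log D.carets ≤ C * wordLength S x + C ∧
            (wordLength S x : ℝ) ≤ C * (D.carets * Real.log D.carets) + C := by
  refine ⟨⟨closure_brinGenerators, exists_isReducedFor,
    exists_wordLength_bounds finite_brinGenerators closure_brinGenerators⟩, fun n hn => ?_⟩
  have : NeZero n := ⟨by omega⟩
  exact ⟨Group.fg_iff.2 ⟨moves n, closure_moves n, finite_moves n⟩, exists_isReducedFor,
    fun S hS hcl => exists_wordLength_bounds hS hcl⟩
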